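/- Let $m\ge 3$ be an integer. For every $\mu>0$ the system \[ u'+\tfrac{m-2}{2}u=\cosh(t)^{-\frac1{m-1}}(u^2+v^2)^{\frac1{m-1}}v,\qquad -v'+\tfrac{m-2}{2}v=\cosh(t)^{-\frac1{m-1}}(u^2+v^2)^{\frac1{m-1}}u \] with $u(0)=v(0)=\mu$ has a unique solution $(u_\mu,v_\mu)$ defined on all of $\mathbb R$. Put \[ H_\mu(t)=-\tfrac{m-2}{2}u_\mu(t)v_\mu(t)+\tfrac{m-1}{2m}\cosh(t)^{-\frac1{m-1}}\big(u_\mu(t)^2+v_\mu(t)^2\big)^{\frac m{m-1}}, \] and for $k\in\mathbb N\cup\{0\}$ let \[ A_k=\Big\{\mu>0:\ v_\mu\text{ changes sign exactly }k\text{ times on }(0,\infty)\text{ and }\lim_{|t|\to\infty}H_\mu(t)\text{ exists in }[-\infty,0)\Big\}, \] \[ I_k=\Big\{\mu>0:\ v_\mu\text{ changes sign exactly }k\text{ times on }(0,\infty)\text{ and }H_\mu(t)>0\text{ for all }t\in\mathbb R\Big\}. \] Then $(0,\infty)$ is the disjoint union of $\bigcup_{k\ge0}A_k$ and $\bigcup_{k\ge0}I_k$,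 and the following hold for all $k\ge 0$. 1. $A_k$ is a nonempty, bounded, open subset of $\mathbb R$. 2. If $\mu_k=\sup A_k$, then $\mu_k\in I_k$; moreover $\mu_0<\mu_1<\mu_2<\cdots$ and $\mu_k\to+\infty$ as $k\to\infty$. 3. $I_k$ is nonempty, $\nu_k=\sup I_k$ is finite, and there is $\varepsilon>0$ with $(\nu_k,\nu_k+\varepsilon)\subset A_{k+1}$. 4. If $\mu\in I_k$, then $(u_\mu(t),v_\mu(t))\to(0,0)$ as $|t|\to\infty$, and $u_\mu(t)^2+v_\mu(t)^2=O\big(e^{-(m-2)|t|}\big)$ as $|t|\to\infty$. 5. If $\mu\in A_k$, then there is $c>0$ with $u_\mu(t)^2+v_\mu(t)^2\ge c$ for all $t\in\mathbb R$; moreover $u_\mu(t)^2+v_\mu(t)^2\to+\infty$ and $u_\mu(t)^2+v_\mu(t)^2=O(\cosh t)$ as $|t|\to\infty$. -/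

import Mathlib

open Set Filter Topology Asymptotics

noncomputable section

/-- `(u, v)` is a solution, defined on all of `ℝ`, of the system
`u' + (m-2)/2 * u = cosh(t)^(-1/(m-1)) * (u² + v²)^(1/(m-1)) * v`,
`-v' + (m-2)/2 * v = cosh(t)^(-1/(m-1)) * (u² + v²)^(1/(m-1)) * u`,
with `u(0) = v(0) = μ`. -/
structure IsDissipativeSolution (m : ℕ) (μ : ℝ) (u v : ℝ → ℝ) : Prop where
  differentiable_fst : Differentiable ℝ u
  differentiable_snd : Differentiable ℝ v
  eq_fst : ∀ t : ℝ, deriv u t + ((m : ℝ) - 2) / 2 * u t =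
    Real.cosh t ^ (-(1 / ((m : ℝ) - 1))) * (u t ^ 2 + v t ^ 2) ^ (1 / ((m : ℝ) - 1)) * v t
  eq_snd : ∀ t : ℝ, -deriv v t + ((m : ℝ) - 2) / 2 * v t =
    Real.cosh t ^ (-(1 / ((m : ℝ) - 1))) * (u t ^ 2 + v t ^ 2) ^ (1 / ((m : ℝ) - 1)) * u t
  init_fst : u 0 = μ
  init_snd : v 0 = μ

/-- The Hamiltonian energy along the trajectory `(u, v)` at time `t`. -/
def hamiltonianEnergy (m : ℕ) (u v : ℝ → ℝ) (t : ℝ) : ℝ :=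
  -(((m : ℝ) - 2) / 2) * u t * v t +
    ((m : ℝ) - 1) / (2 * (m : ℝ)) * Real.cosh t ^ (-(1 / ((m : ℝ) - 1))) *
      (u t ^ 2 + v t ^ 2) ^ ((m : ℝ) / ((m : ℝ) - 1))

/-- `f` changes sign at least `n` times on `S`: there are points `t₀ < t₁ < ⋯ < tₙ` of `S` such
that `f` takes values of strictly opposite signs at consecutive points. -/
def ChangesSignAtLeast (f : ℝ → ℝ) (S : Set ℝ) (n : ℕ) : Prop :=
  ∃ t : Fin (n + 1) → ℝ, StrictMono t ∧ (∀ i, t i ∈ S) ∧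
    ∀ i : Fin n, f (t i.castSucc) * f (t i.succ) < 0

/-- `f` changes sign exactly `k` times on `S`. -/
def ChangesSignExactly (f : ℝ → ℝ) (S : Set ℝ) (k : ℕ) : Prop :=
  ChangesSignAtLeast f S k ∧ ¬ ChangesSignAtLeast f S (k + 1)

/-- The class `A_k` of initial data `μ > 0`, for a family `μ ↦ (u μ, v μ)` of trajectories:
`v μ` changes sign `k` times on `(0, ∞)`, and the energy has a negative limit, possibly `-∞`,
as `|t| → ∞`. The filter `cocompact ℝ` expresses `|t| → ∞`. -/
def classA (m : ℕ) (u v : ℝ → ℝ → ℝ) (k : ℕ) : Set ℝ :=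
  {μ : ℝ | 0 < μ ∧ ChangesSignExactly (v μ) (Ioi 0) k ∧
    ∃ L : EReal, L < 0 ∧
      Tendsto (fun t : ℝ => (hamiltonianEnergy m (u μ) (v μ) t : EReal)) (cocompact ℝ) (𝓝 L)}

/-- The class `I_k` of initial data `μ > 0`, for a family `μ ↦ (u μ, v μ)` of trajectories:
`v μ` changes sign `k` times on `(0, ∞)`, and the energy is positive at all times. -/
def classI (m : ℕ) (u v : ℝ → ℝ → ℝ) (k : ℕ) : Set ℝ :=
  {μ : ℝ | 0 < μ ∧ ChangesSignExactly (v μ) (Ioi 0) k ∧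
    ∀ t : ℝ, 0 < hamiltonianEnergy m (u μ) (v μ) t}

end

/-!
The system becomes planar in polar coordinates `u = e^{z/2} cos (φ/2)`, `v = e^{z/2} sin (φ/2)`:
with the forcing `Y = 2 (e^z / cosh t)^{1/(m-1)}` it reads
`φ' = (m-2) sin φ - Y`, `z' = -(m-2) cos φ`, and `φ(0) = π/2`, `z(0) = log (2 μ²)`.
Since `|z'| ≤ m-2`, solutions are global; they are unique because the radius never vanishes, and the
time reversal `(u, v) ↦ (v(-t), u(-t))` reduces everything to `t ≥ 0`. The zeros of `v` are the
passages of `φ` through multiples of `2π`, which go only downwards because `φ' = -Y < 0` there.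

The energy `H` is a positive multiple of `e^z (Y - m(m-2)/(m-1) sin φ)`, and its derivative is
`-tanh t · Y e^z` up to a positive factor. Once `H ≤ 0`, the angle is trapped in an interval
`(-2πk, -2πk + π)` (`IsTrapped`, the class `A_k`). If `H > 0` forever, then `φ` decreases. As `Y`
varies at most by the factor `e` in unit time and `e^z = (Y/2)^{m-1} cosh t`, a forcing of
a given size at a late time costs more energy than is available (`exists_forcing_lt`). So `Y → 0`,
the angle cannot turn forever, and it converges to some `-2πk` (`IsDecaying`, the class `I_k`).

The same energy estimate, uniform in the initial value, shows that a neighbourhood of a point of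
`I_k` lies in `A_k ∪ I_k ∪ A_{k+1}` (`eventually_of_isDecaying`): a further turn with positive
energy would require a large forcing at a late time. Each `A_k` is open by continuous dependence, `A_0`
contains the small initial values, and large initial values turn many times before time `1`, so
`A_k` and `I_k` are bounded. These facts alone determine the order of the sets
(`alternating_families`). The growth and decay rates come from monotone quantities along trapped and
decaying solutions.
-/

/-! ### Real functions with a sign condition on the derivative -/

lemma antitoneOn_Ici_of_hasDerivAt_nonpos {f f' : ℝ → ℝ} {a : ℝ}
    (hf : ∀ t, HasDerivAt f (f' t) t) (h : ∀ t, a < t → f' t ≤ 0) : AntitoneOn f (Ici a) := by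
  refine antitoneOn_of_deriv_nonpos (convex_Ici a)
    (fun t _ => (hf t).continuousAt.continuousWithinAt)
    (fun t _ => (hf t).differentiableAt.differentiableWithinAt) fun t ht => ?_
  rw [interior_Ici] at ht
  rw [(hf t).deriv]
  exact h t ht

lemma strictAntiOn_Ici_of_hasDerivAt_neg {f f' : ℝ → ℝ} {a : ℝ}
    (hf : ∀ t, HasDerivAt f (f' t) t) (h : ∀ t, a < t → f' t < 0) : StrictAntiOn f (Ici a) := by
  refine strictAntiOn_of_deriv_neg (convex_Ici a)
    (fun t _ => (hf t).continuousAt.continuousWithinAt) fun t ht => ?_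
  rw [interior_Ici] at ht
  rw [(hf t).deriv]
  exact h t ht

lemma tendsto_atBot_of_hasDerivAt_le {f f' : ℝ → ℝ} {a δ : ℝ} (hδ : 0 < δ)
    (hf : ∀ t, HasDerivAt f (f' t) t) (h : ∀ t, a < t → f' t ≤ -δ) : Tendsto f atTop atBot := by
  have hanti : AntitoneOn (fun t => f t + δ * t) (Ici a) :=
    antitoneOn_Ici_of_hasDerivAt_nonpos
      (fun t => (hf t).add ((hasDerivAt_id t).const_mul δ)) fun t ht => by
        have := h t ht
        linarith
  have hlim : Tendsto (fun t : ℝ => f a + δ * a - δ * t) atTop atBot :=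
    tendsto_atBot_add_const_left _ _ (tendsto_neg_atTop_atBot.comp
      (tendsto_id.const_mul_atTop hδ))
  refine tendsto_atBot_mono' atTop ?_ hlim
  filter_upwards [eventually_ge_atTop a] with t ht
  have := hanti (mem_Ici.2 le_rfl) (mem_Ici.2 ht) ht
  simp only at this
  linarith

/-- A function whose derivative is negative wherever it takes the value `c` can cross the level `c`
only downwards, and only once. -/
lemma lt_of_le_of_deriv_neg_on_level {f f' : ℝ → ℝ} {c : ℝ} (hf : ∀ t, HasDerivAt f (f' t) t)
    (h : ∀ t, f t = c → f' t < 0) {s t : ℝ} (hst : s < t) (hs : f s ≤ c) : f t < c := by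
  have hle : ∀ x, s ≤ x → f x ≤ c := fun x hx =>
    image_le_of_deriv_right_lt_deriv_boundary' (f' := f') (B := fun _ => c) (B' := fun _ => 0)
      (fun y _ => (hf y).continuousAt.continuousWithinAt) (fun y _ => (hf y).hasDerivWithinAt)
      hs continuousOn_const (fun y _ => hasDerivWithinAt_const ..) (fun y _ => h y)
      (right_mem_Icc.2 hx)
  refine lt_of_le_of_ne (hle t hst.le) fun heq => ?_
  have hmax : IsLocalMax f t := by
    filter_upwards [eventually_gt_nhds hst] with x hx
    rw [heq]
    exact hle x hx.le
  exact (h t heq).ne (hmax.hasDerivAt_eq_zero (hf t))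

/-! ### Counting sign changes through the angle -/

lemma ChangesSignAtLeast.mono {f : ℝ → ℝ} {S : Set ℝ} {n k : ℕ} (h : ChangesSignAtLeast f S n)
    (hkn : k ≤ n) : ChangesSignAtLeast f S k := by
  obtain ⟨t, ht, htS, hsign⟩ := h
  have hk : k + 1 ≤ n + 1 := by omega
  refine ⟨fun i => t (Fin.castLE hk i), fun i j hij => ht (by simpa using hij), fun i => htS _,
    fun i => ?_⟩
  exact hsign (Fin.castLE hkn i)

lemma ChangesSignExactly.unique {f : ℝ → ℝ} {S : Set ℝ} {k l : ℕ} (hk : ChangesSignExactly f S k)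
    (hl : ChangesSignExactly f S l) : k = l := by
  rcases lt_trichotomy k l with h | h | h
  · exact absurd (hl.1.mono h) hk.2
  · exact h
  · exact absurd (hk.1.mono h) hl.2

/-- The index `n` of the sector `[-2πn, -2πn + 2π)` that contains the angle `x`. On this sector
`sin (x / 2)` has the sign `(-1)ⁿ`. -/
noncomputable def sectorIndex (x : ℝ) : ℤ := ⌈-x / (2 * Real.pi)⌉

lemma sectorIndex_le_iff {x : ℝ} {n : ℤ} : sectorIndex x ≤ n ↔ -(2 * Real.pi * n) ≤ x := by
  rw [sectorIndex, Int.ceil_le, div_le_iff₀ (by positivity)]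
  constructor <;> intro h <;> linarith

lemma sin_half_mul_sin_half_nonneg {x y : ℝ} (h : sectorIndex x = sectorIndex y) :
    0 ≤ Real.sin (x / 2) * Real.sin (y / 2) := by
  have key : ∀ w : ℝ, 0 ≤ Real.sin (w / 2 + sectorIndex w * Real.pi) := fun w => by
    have h1 : -(2 * Real.pi * sectorIndex w) ≤ w := sectorIndex_le_iff.1 le_rfl
    have h2 : ¬ sectorIndex w ≤ sectorIndex w - 1 := by omega
    rw [sectorIndex_le_iff] at h2
    push_cast at h2
    apply Real.sin_nonneg_of_nonneg_of_le_pi <;> linarith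
  have hx := key x
  have hy := key y
  rw [← h] at hy
  rw [Real.sin_add_int_mul_pi] at hx hy
  have hsq : ((-1 : ℝ) ^ sectorIndex x) * ((-1 : ℝ) ^ sectorIndex x) = 1 := by
    rw [← mul_zpow]
    simp
  have := mul_nonneg hx hy
  calc (0 : ℝ) ≤ _ := this
    _ = ((-1 : ℝ) ^ sectorIndex x * (-1 : ℝ) ^ sectorIndex x) *
        (Real.sin (x / 2) * Real.sin (y / 2)) := by ring
    _ = _ := by rw [hsq, one_mul]

/-- If the angle `φ` starts at `π/2`, crosses each level `-2πn` only downwards, stays above `-2πk`,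
and reaches the sector `(-2πk, -2πk + 2π)`, then `ρ sin (φ/2)` changes sign exactly `k` times for
every positive factor `ρ`. -/
lemma changesSignExactly_of_angle {φ ρ : ℝ → ℝ} {k : ℕ} (hφ : Continuous φ) (hρ : ∀ t, 0 < ρ t)
    (h0 : φ 0 = Real.pi / 2)
    (hcross : ∀ (n : ℤ) (s t : ℝ), s < t → φ s ≤ n * Real.pi → φ t < n * Real.pi)
    (hlow : ∀ t, 0 < t → -(2 * Real.pi * k) < φ t)
    {T : ℝ} (hT : 0 < T) (hφT : φ T < -(2 * Real.pi * k) + 2 * Real.pi) :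
    ChangesSignExactly (fun t => ρ t * Real.sin (φ t / 2)) (Ioi 0) k := by
  have hπ := Real.pi_pos
  have hup : ∀ t, 0 < t → φ t < Real.pi := fun t ht => by
    have := hcross 1 0 t ht (by rw [h0]; push_cast; linarith)
    simpa using this
  constructor
  · -- one point in each of the sectors `0, …, k`
    have hex : ∀ i : Fin (k + 1), ∃ t, 0 < t ∧ -(2 * Real.pi * (i : ℕ)) < φ t ∧
        φ t < -(2 * Real.pi * (i : ℕ)) + 2 * Real.pi := by
      intro i
      rcases Nat.lt_succ_iff_lt_or_eq.1 i.2 with hi | hi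
      · have hi' : ((i : ℕ) : ℝ) + 1 ≤ k := by exact_mod_cast hi
        have hi0 : (0 : ℝ) ≤ (i : ℕ) := by positivity
        have hmem : -(2 * Real.pi * (i : ℕ)) + 1 ∈ Icc (φ T) (φ 0) := by
          rw [h0]
          have h3 := Real.pi_gt_three
          constructor <;> nlinarith
        obtain ⟨t, ht, hφt⟩ := intermediate_value_Icc' hT.le hφ.continuousOn hmem
        refine ⟨t, lt_of_le_of_ne ht.1 ?_, ?_, ?_⟩
        · rintro rfl
          rw [h0] at hφt
          have h3 := Real.pi_gt_three
          nlinarith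
        · linarith
        · have h3 := Real.pi_gt_three
          linarith
      · rw [hi]
        exact ⟨T, hT, hlow T hT, hφT⟩
    choose t ht htl htu using hex
    have hmono : StrictMono t := by
      rw [Fin.strictMono_iff_lt_succ]
      intro i
      by_contra! hle
      have h1 := htl i.castSucc
      have h2 := htu i.succ
      simp only [Fin.val_castSucc, Fin.val_succ, Nat.cast_add, Nat.cast_one] at h1 h2
      rcases hle.lt_or_eq with h | h
      · have := hcross (-(2 * (i : ℕ))) _ _ h (by push_cast; linarith)
        push_cast at this
        linarith
      · rw [h] at h2
        linarith
    refine ⟨t, hmono, ht, fun i => ?_⟩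
    have hpos : ∀ j : Fin (k + 1), 0 < (-1 : ℝ) ^ (j : ℕ) * Real.sin (φ (t j) / 2) := fun j => by
      rw [← Real.sin_add_nat_mul_pi]
      have h1 := htl j
      have h2 := htu j
      apply Real.sin_pos_of_pos_of_lt_pi <;> linarith
    have h1 := hpos i.castSucc
    have h2 := hpos i.succ
    simp only [Fin.val_castSucc, Fin.val_succ, pow_succ] at h1 h2
    have hsq : ((-1 : ℝ) ^ (i : ℕ)) * ((-1 : ℝ) ^ (i : ℕ)) = 1 := by
      rw [← mul_pow]; simp
    have h3 := mul_pos h1 h2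
    have h4 : Real.sin (φ (t i.castSucc) / 2) * Real.sin (φ (t i.succ) / 2) < 0 := by
      have : (-1 : ℝ) ^ (i : ℕ) * Real.sin (φ (t i.castSucc) / 2) *
          ((-1 : ℝ) ^ (i : ℕ) * -1 * Real.sin (φ (t i.succ) / 2)) =
          (((-1 : ℝ) ^ (i : ℕ)) * ((-1 : ℝ) ^ (i : ℕ))) *
          -(Real.sin (φ (t i.castSucc) / 2) * Real.sin (φ (t i.succ) / 2)) := by ring
      rw [this, hsq] at h3
      linarith
    have h5 := mul_neg_of_pos_of_neg (mul_pos (hρ (t i.castSucc)) (hρ (t i.succ))) h4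
    calc _ = ρ (t i.castSucc) * ρ (t i.succ) *
          (Real.sin (φ (t i.castSucc) / 2) * Real.sin (φ (t i.succ) / 2)) := by ring
      _ < 0 := h5
  · rintro ⟨t, hmono, htpos, hsign⟩
    have hsec : ∀ s s', 0 < s → s < s' → sectorIndex (φ s) ≤ sectorIndex (φ s') := by
      intro s s' hs hss
      rw [sectorIndex_le_iff]
      by_contra! hlt
      have := hcross (-(2 * sectorIndex (φ s'))) s s' hss (by push_cast; linarith)
      push_cast at this
      have h2 := sectorIndex_le_iff.1 (le_refl (sectorIndex (φ s')))
      linarith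
    -- the sector index grows by at least one at each sign change
    have hgrow : ∀ n : ℕ, ∀ hn : n < k + 2, (n : ℤ) ≤ sectorIndex (φ (t ⟨n, hn⟩)) := by
      intro n
      induction n with
      | zero =>
        intro hn
        by_contra! hlt
        have h1 : sectorIndex (φ (t ⟨0, hn⟩)) ≤ -1 := by push_cast at hlt; omega
        rw [sectorIndex_le_iff] at h1
        have h2 := hup _ (htpos ⟨0, hn⟩)
        push_cast at h1
        linarith
      | succ n ih =>
        intro hn
        have h1 := ih (by omega)
        have h2 := hsign ⟨n, by omega⟩
        have hlt : (⟨n, by omega⟩ : Fin (k + 1 + 1)) < ⟨n + 1, hn⟩ := by simp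
        have h3 := hsec _ _ (htpos ⟨n, by omega⟩) (hmono hlt)
        rcases h3.lt_or_eq with h | h
        · push_cast
          omega
        · exfalso
          have h4 := sin_half_mul_sin_half_nonneg h
          have h5 := mul_nonneg (mul_pos (hρ (t ⟨n, by omega⟩)) (hρ (t ⟨n + 1, hn⟩))).le h4
          simp only [Fin.castSucc_mk, Fin.succ_mk] at h2
          linarith
    have h1 := hgrow (k + 1) (by omega)
    have h2 : sectorIndex (φ (t ⟨k + 1, by omega⟩)) ≤ k := by
      rw [sectorIndex_le_iff]
      have := hlow _ (htpos ⟨k + 1, by omega⟩)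
      push_cast
      linarith
    push_cast at h1
    omega

/-! ### The order of the two families of sets -/

/-- The order structure of two families of sets `A k`, `I k` that partition `(0, ∞)`, where the
`A k` are open and a point of `I k` has a neighbourhood contained in `A k ∪ I k ∪ A (k + 1)`. -/
theorem alternating_families {A I : ℕ → Set ℝ}
    (hcover : ∀ x, 0 < x → ∃ k, x ∈ A k ∨ x ∈ I k)
    (hApos : ∀ k, A k ⊆ Ioi 0) (hIpos : ∀ k, I k ⊆ Ioi 0)
    (hAA : ∀ k l x, x ∈ A k → x ∈ A l → k = l) (hII : ∀ k l x, x ∈ I k → x ∈ I l → k = l)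
    (hAI : ∀ k l x, x ∈ A k → x ∉ I l)
    (hopen : ∀ k, IsOpen (A k)) (hA0 : (A 0).Nonempty)
    (hAbdd : ∀ k, BddAbove (A k)) (hIbdd : ∀ k, BddAbove (I k))
    (hnear : ∀ k, ∀ x ∈ I k, ∀ᶠ y in 𝓝 x, y ∈ A k ∨ y ∈ I k ∨ y ∈ A (k + 1)) :
    (∀ k, (A k).Nonempty ∧ sSup (A k) ∈ I k ∧
      ∃ ε : ℝ, 0 < ε ∧ Ioo (sSup (I k)) (sSup (I k) + ε) ⊆ A (k + 1)) ∧
    StrictMono (fun k => sSup (A k)) ∧ Tendsto (fun k => sSup (A k)) atTop atTop := by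
  have hsupA_pos : ∀ k, (A k).Nonempty → 0 < sSup (A k) := fun k ⟨x, hx⟩ =>
    lt_of_lt_of_le (hApos k hx) (le_csSup (hAbdd k) hx)
  -- every neighbourhood of the supremum contains points of the set
  have hfreq : ∀ (S : Set ℝ), S.Nonempty → BddAbove S → ∀ P : ℝ → Prop,
      (∀ᶠ y in 𝓝 (sSup S), P y) → ∃ y ∈ S, P y := fun S hS hb P hP => by
    have hcl := csSup_mem_closure hS hb
    obtain ⟨y, hy, hyS⟩ := mem_closure_iff_nhds.1 hcl _ hP
    exact ⟨y, hyS, hy⟩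
  have hsupA : ∀ k, (A k).Nonempty → ∃ j, sSup (A k) ∈ I j ∧ (k = j ∨ k = j + 1) := by
    intro k hk
    obtain ⟨j, hj | hj⟩ := hcover _ (hsupA_pos k hk)
    · exfalso
      obtain ⟨y, hyk, hyj⟩ := hfreq _ hk (hAbdd k) _ ((hopen j).mem_nhds hj)
      have hkj := hAA _ _ _ hyk hyj
      subst hkj
      obtain ⟨ε, hε, hball⟩ := Metric.isOpen_iff.1 (hopen k) _ hj
      have hmem : sSup (A k) + ε / 2 ∈ A k := hball (by
        rw [Metric.mem_ball, Real.dist_eq, add_sub_cancel_left, abs_of_pos (by linarith)]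
        linarith)
      have := le_csSup (hAbdd k) hmem
      linarith
    · refine ⟨j, hj, ?_⟩
      obtain ⟨y, hyk, hy | hy | hy⟩ := hfreq _ hk (hAbdd k) _ (hnear j _ hj)
      · exact Or.inl (hAA _ _ _ hyk hy)
      · exact absurd hy (hAI _ _ _ hyk)
      · exact Or.inr (hAA _ _ _ hyk hy)
  have hsupI : ∀ k, (I k).Nonempty → sSup (I k) ∈ I k := by
    rintro k ⟨x, hx⟩
    have hpos : 0 < sSup (I k) := lt_of_lt_of_le (hIpos k hx) (le_csSup (hIbdd k) hx)
    obtain ⟨j, hj | hj⟩ := hcover _ hpos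
    · exfalso
      obtain ⟨y, hyk, hyj⟩ := hfreq _ ⟨x, hx⟩ (hIbdd k) _ ((hopen j).mem_nhds hj)
      exact hAI _ _ _ hyj hyk
    · obtain ⟨y, hyk, hy | hy | hy⟩ := hfreq _ ⟨x, hx⟩ (hIbdd k) _ (hnear j _ hj)
      · exact absurd hyk (hAI _ _ _ hy)
      · rw [hII _ _ _ hyk hy]
        exact hII _ _ _ hyk hy ▸ hj
      · exact absurd hyk (hAI _ _ _ hy)
  -- to the right of `sup (I k)` only `A (k + 1)` is left
  have hright : ∀ k, sSup (A k) ∈ I k →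
      ∃ ε : ℝ, 0 < ε ∧ Ioo (sSup (I k)) (sSup (I k) + ε) ⊆ A (k + 1) := by
    intro k hk
    have hle : sSup (A k) ≤ sSup (I k) := le_csSup (hIbdd k) hk
    obtain ⟨ε, hε, hball⟩ := Metric.eventually_nhds_iff.1 (hnear k _ (hsupI k ⟨_, hk⟩))
    refine ⟨ε, hε, fun y hy => ?_⟩
    have hd : dist y (sSup (I k)) < ε := by
      rw [Real.dist_eq, abs_of_pos (by linarith [hy.1])]
      linarith [hy.2]
    rcases hball hd with h | h | h
    · have := le_csSup (hAbdd k) h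
      linarith [hy.1]
    · have := le_csSup (hIbdd k) h
      linarith [hy.1]
    · exact h
  have hstep : ∀ k, sSup (A k) ∈ I k → (A (k + 1)).Nonempty ∧ sSup (I k) < sSup (A (k + 1)) := by
    intro k hk
    obtain ⟨ε, hε, hsub⟩ := hright k hk
    have hmem : sSup (I k) + ε / 2 ∈ A (k + 1) := hsub ⟨by linarith, by linarith⟩
    have := le_csSup (hAbdd (k + 1)) hmem
    exact ⟨⟨_, hmem⟩, by linarith⟩
  have hmain : ∀ k, (A k).Nonempty ∧ sSup (A k) ∈ I k := by
    intro k
    induction k with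
    | zero =>
      obtain ⟨j, hj, h | h⟩ := hsupA 0 hA0
      · exact ⟨hA0, h ▸ hj⟩
      · omega
    | succ k ih =>
      obtain ⟨hne, hlt⟩ := hstep k ih.2
      refine ⟨hne, ?_⟩
      obtain ⟨j, hj, h | h⟩ := hsupA (k + 1) hne
      · exact h ▸ hj
      · obtain rfl : k = j := by omega
        have := le_csSup (hIbdd k) hj
        linarith
  have hmono : StrictMono (fun k => sSup (A k)) := strictMono_nat_of_lt_succ fun k =>
    lt_of_le_of_lt (le_csSup (hIbdd k) (hmain k).2) (hstep k (hmain k).2).2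
  refine ⟨fun k => ⟨(hmain k).1, (hmain k).2, hright k (hmain k).2⟩, hmono, ?_⟩
  refine (tendsto_atTop_of_monotone hmono.monotone).resolve_right ?_
  rintro ⟨l, hl⟩
  have hlpos : 0 < l := lt_of_lt_of_le (hsupA_pos 0 hA0) (hmono.monotone.ge_of_tendsto hl 0)
  -- near a finite limit only one index `j` of the sets `I j` would be possible
  obtain ⟨j, hj⟩ : ∃ j, ∀ᶠ y in 𝓝 l, ∀ i, y ∈ I i → i = j := by
    obtain ⟨j, hj | hj⟩ := hcover l hlpos
    · refine ⟨j, ?_⟩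
      filter_upwards [(hopen j).mem_nhds hj] with y hy i hi
      exact absurd hi (hAI _ _ _ hy)
    · refine ⟨j, ?_⟩
      filter_upwards [hnear j l hj] with y hy i hi
      rcases hy with h | h | h
      · exact absurd hi (hAI _ _ _ h)
      · exact hII _ _ _ hi h
      · exact absurd hi (hAI _ _ _ h)
  obtain ⟨N, hN⟩ := eventually_atTop.1 (hl.eventually hj)
  have h1 := hN N le_rfl N (hmain N).2
  have h2 := hN (N + 1) (by omega) (N + 1) (hmain (N + 1)).2
  omega

/-! ### Global solutions of ordinary differential equations -/

/-- A vector field that is, on each bounded time interval, bounded and Lipschitz in space, has a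
global solution through every point. -/
theorem exists_forall_hasDerivAt_of_lipschitzWith {E : Type*} [NormedAddCommGroup E]
    [NormedSpace ℝ E] [CompleteSpace E] {F : ℝ → E → E} {K L : ℝ → NNReal}
    (hlip : ∀ T, ∀ t ∈ Icc (-T) T, LipschitzWith (K T) (F t))
    (hcont : ∀ x, Continuous fun t => F t x)
    (hbd : ∀ T, ∀ t ∈ Icc (-T) T, ∀ x, ‖F t x‖ ≤ L T) (x₀ : E) :
    ∃ α : ℝ → E, α 0 = x₀ ∧ ∀ t, HasDerivAt α (F t (α t)) t := by
  have hloc : ∀ n : ℕ, ∃ α : ℝ → E, α 0 = x₀ ∧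
      ∀ t ∈ Ioo (-((n : ℝ) + 1)) (n + 1), HasDerivAt α (F t (α t)) t := by
    intro n
    set T : ℝ := (n : ℝ) + 1 with hT
    have hT0 : 0 < T := by positivity
    have hpl : IsPicardLindelof F (tmin := -T) (tmax := T) ⟨0, by constructor <;> linarith⟩ x₀
        (L T * T.toNNReal) 0 (L T) (K T) :=
      { lipschitzOnWith := fun t ht => (hlip T t ht).lipschitzOnWith
        continuousOn := fun x _ => (hcont x).continuousOn
        norm_le := fun t ht x _ => hbd T t ht x
        mul_max_le := by simp [hT0.le] }
    obtain ⟨α, hα0, hα⟩ := hpl.exists_eq_forall_mem_Icc_hasDerivWithinAt₀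
    exact ⟨α, hα0, fun t ht => (hα t (Ioo_subset_Icc_self ht)).hasDerivAt (Icc_mem_nhds ht.1 ht.2)⟩
  choose α hα0 hα using hloc
  have hagree : ∀ n k : ℕ, n ≤ k → EqOn (α n) (α k) (Ioo (-((n : ℝ) + 1)) (n + 1)) := by
    intro n k hnk
    have hnk' : (n : ℝ) ≤ k := by exact_mod_cast hnk
    have hn0 : (0 : ℝ) < n + 1 := by positivity
    refine ODE_solution_unique_of_mem_Ioo (v := F) (s := fun _ => univ) (K := K (n + 1))
      (t₀ := 0) (fun t ht => (hlip _ t (Ioo_subset_Icc_self ht)).lipschitzOnWith)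
      ⟨by linarith, by linarith⟩ (fun t ht => ⟨hα n t ht, mem_univ _⟩)
      (fun t ht => ⟨hα k t ⟨by linarith [ht.1], by linarith [ht.2]⟩, mem_univ _⟩) ?_
    rw [hα0, hα0]
  refine ⟨fun t => α ⌈|t|⌉₊ t, by simp [hα0], fun t => ?_⟩
  set n : ℕ := ⌈|t|⌉₊ + 1 with hn
  have hmem : ∀ s : ℝ, s ∈ Ioo (-((⌈|s|⌉₊ : ℝ) + 1)) (⌈|s|⌉₊ + 1) := fun s => by
    have h1 := Nat.le_ceil |s|
    have h2 := abs_le.1 h1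
    constructor <;> linarith
  have htn : t ∈ Ioo (-((n : ℝ) + 1)) (n + 1) := by
    have := hmem t
    rw [hn]
    push_cast
    constructor <;> linarith [this.1, this.2]
  have hev : (fun s => α ⌈|s|⌉₊ s) =ᶠ[𝓝 t] α n := by
    have h1 : ∀ᶠ s in 𝓝 t, |s| < |t| + 1 :=
      continuous_abs.continuousAt.eventually_lt continuousAt_const (by linarith)
    filter_upwards [h1] with s hs
    refine hagree _ _ ?_ (hmem s)
    rw [hn, Nat.ceil_le]
    push_cast
    linarith [Nat.le_ceil |t|]
  have hval : α ⌈|t|⌉₊ t = α n t := hev.eq_of_nhds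
  have hd := hα n t htn
  rw [← hval] at hd
  exact hd.congr_of_eventuallyEq hev

/-! ### The system in polar coordinates -/

/-- The nonlinear term `Y = 2 (e^z / cosh t)^{1/(m-1)}` of the system in polar coordinates, where
`z` is the logarithm of `u² + v²`. -/
noncomputable def polarForcing (m : ℕ) (t z : ℝ) : ℝ :=
  2 * Real.exp (z / ((m : ℝ) - 1)) * Real.cosh t ^ (-(1 / ((m : ℝ) - 1)))

/-- `(φ, z)` solves the system in polar coordinates `u = e^{z/2} cos (φ/2)`,
`v = e^{z/2} sin (φ/2)`, with `u(0) = v(0) > 0` and `u(0)² + v(0)² = e^ζ`. -/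
structure IsPolarSolution (m : ℕ) (ζ : ℝ) (φ z : ℝ → ℝ) : Prop where
  angle : ∀ t, HasDerivAt φ (((m : ℝ) - 2) * Real.sin (φ t) - polarForcing m t (z t)) t
  logRadius : ∀ t, HasDerivAt z (-((m : ℝ) - 2) * Real.cos (φ t)) t
  angle_zero : φ 0 = Real.pi / 2
  logRadius_zero : z 0 = ζ

/-- The polar vector field, with `z` replaced by `min z (Z + (m-2)|t|)` in the nonlinear term. This
field is globally Lipschitz in space, and the replacement does not affect solutions with
`z 0 ≤ Z`. -/
noncomputable def truncatedPolarField (m : ℕ) (Z t : ℝ) (x : ℝ × ℝ) : ℝ × ℝ :=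
  (((m : ℝ) - 2) * Real.sin x.1 - polarForcing m t (min x.2 (Z + ((m : ℝ) - 2) * |t|)),
    -((m : ℝ) - 2) * Real.cos x.1)

lemma polarForcing_pos (m : ℕ) (t z : ℝ) : 0 < polarForcing m t z := by
  unfold polarForcing
  have := Real.rpow_pos_of_pos (Real.cosh_pos t) (-(1 / ((m : ℝ) - 1)))
  positivity

lemma cosh_rpow_le_one {m : ℕ} (hm : 3 ≤ m) (t : ℝ) :
    Real.cosh t ^ (-(1 / ((m : ℝ) - 1))) ≤ 1 := by
  have hm' : (3 : ℝ) ≤ m := by exact_mod_cast hm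
  apply Real.rpow_le_one_of_one_le_of_nonpos (Real.one_le_cosh t)
  have : 0 < 1 / ((m : ℝ) - 1) := by apply one_div_pos.2; linarith
  linarith

lemma abs_exp_sub_exp_le {a b M : ℝ} (ha : a ≤ M) (hb : b ≤ M) :
    |Real.exp a - Real.exp b| ≤ Real.exp M * |a - b| := by
  wlog hab : b ≤ a generalizing a b with H
  · rw [abs_sub_comm, abs_sub_comm a]
    exact H hb ha (le_of_not_ge hab)
  rw [abs_of_nonneg (sub_nonneg.2 (Real.exp_le_exp.2 hab)), abs_of_nonneg (sub_nonneg.2 hab)]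
  have h1 : Real.exp b = Real.exp a * Real.exp (b - a) := by rw [← Real.exp_add]; ring_nf
  have h2 := Real.add_one_le_exp (b - a)
  have h3 := Real.exp_le_exp.2 ha
  have h4 := Real.exp_pos a
  calc Real.exp a - Real.exp b = Real.exp a * (1 - Real.exp (b - a)) := by rw [h1]; ring
    _ ≤ Real.exp a * (a - b) := by
      apply mul_le_mul_of_nonneg_left _ h4.le
      linarith
    _ ≤ Real.exp M * (a - b) := by
      apply mul_le_mul_of_nonneg_right h3
      linarith

/-- A common bound and Lipschitz constant of the truncated polar field on `[-T, T]`. -/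
noncomputable def polarBound (m : ℕ) (Z T : ℝ) : NNReal :=
  (((m : ℝ) - 2) + 2 * Real.exp ((Z + ((m : ℝ) - 2) * T) / ((m : ℝ) - 1))).toNNReal

lemma coe_polarBound {m : ℕ} (hm : 3 ≤ m) (Z T : ℝ) : (polarBound m Z T : ℝ) =
    ((m : ℝ) - 2) + 2 * Real.exp ((Z + ((m : ℝ) - 2) * T) / ((m : ℝ) - 1)) := by
  have hm' : (3 : ℝ) ≤ m := by exact_mod_cast hm
  rw [polarBound, Real.coe_toNNReal]
  have := Real.exp_pos ((Z + ((m : ℝ) - 2) * T) / ((m : ℝ) - 1))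
  linarith

lemma truncation_div_le {m : ℕ} (hm : 3 ≤ m) {Z T t : ℝ} (ht : t ∈ Icc (-T) T) (z : ℝ) :
    min z (Z + ((m : ℝ) - 2) * |t|) / ((m : ℝ) - 1) ≤
      (Z + ((m : ℝ) - 2) * T) / ((m : ℝ) - 1) := by
  have hm' : (3 : ℝ) ≤ m := by exact_mod_cast hm
  have h1 : |t| ≤ T := abs_le.2 ht
  apply div_le_div_of_nonneg_right _ (by linarith : (0 : ℝ) ≤ (m : ℝ) - 1)
  refine (min_le_right _ _).trans ?_
  have := mul_le_mul_of_nonneg_left h1 (by linarith : (0 : ℝ) ≤ (m : ℝ) - 2)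
  linarith

lemma lipschitzWith_truncatedPolarField {m : ℕ} (hm : 3 ≤ m) (Z T : ℝ) {t : ℝ}
    (ht : t ∈ Icc (-T) T) : LipschitzWith (polarBound m Z T) (truncatedPolarField m Z t) := by
  have hm' : (3 : ℝ) ≤ m := by exact_mod_cast hm
  refine LipschitzWith.of_dist_le_mul fun x y => ?_
  rw [coe_polarBound hm]
  set M := Real.exp ((Z + ((m : ℝ) - 2) * T) / ((m : ℝ) - 1)) with hM
  have hM0 : 0 < M := Real.exp_pos _
  have hx1 : |x.1 - y.1| ≤ dist x y := by rw [← Real.dist_eq, Prod.dist_eq]; exact le_max_left _ _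
  have hx2 : |x.2 - y.2| ≤ dist x y := by rw [← Real.dist_eq, Prod.dist_eq]; exact le_max_right _ _
  have hs := Real.abs_sin_sub_sin_le x.1 y.1
  have hc := Real.abs_cos_sub_cos_le x.1 y.1
  have hd : 0 ≤ dist x y := dist_nonneg
  have hforce : |polarForcing m t (min x.2 (Z + ((m : ℝ) - 2) * |t|)) -
      polarForcing m t (min y.2 (Z + ((m : ℝ) - 2) * |t|))| ≤ 2 * M * dist x y := by
    have h1 := abs_exp_sub_exp_le (truncation_div_le hm (Z := Z) ht x.2)
      (truncation_div_le hm (Z := Z) ht y.2)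
    have h2 := abs_min_sub_min_le_max x.2 (Z + ((m : ℝ) - 2) * |t|) y.2 (Z + ((m : ℝ) - 2) * |t|)
    rw [sub_self, abs_zero, max_eq_left (abs_nonneg _)] at h2
    rw [← sub_div, abs_div, abs_of_pos (by linarith : (0 : ℝ) < (m : ℝ) - 1)] at h1
    have h3 := cosh_rpow_le_one hm t
    have h4 := Real.rpow_pos_of_pos (Real.cosh_pos t) (-(1 / ((m : ℝ) - 1)))
    have h5 := (div_le_self (abs_nonneg (min x.2 (Z + ((m : ℝ) - 2) * |t|) -
      min y.2 (Z + ((m : ℝ) - 2) * |t|))) (by linarith : (1 : ℝ) ≤ (m : ℝ) - 1))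
    unfold polarForcing
    rw [← sub_mul, ← mul_sub, abs_mul, abs_mul, abs_two, abs_of_pos h4]
    calc _ ≤ 2 * (M * dist x y) * 1 := by
          gcongr
          exact h1.trans (mul_le_mul_of_nonneg_left (h5.trans (h2.trans hx2)) hM0.le)
      _ = _ := by ring
  rw [Prod.dist_eq]
  refine max_le ?_ ?_
  · rw [Real.dist_eq]
    simp only [truncatedPolarField]
    calc _ = |((m : ℝ) - 2) * (Real.sin x.1 - Real.sin y.1) -
          (polarForcing m t (min x.2 (Z + ((m : ℝ) - 2) * |t|)) -
          polarForcing m t (min y.2 (Z + ((m : ℝ) - 2) * |t|)))| := by ring_nf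
      _ ≤ |((m : ℝ) - 2) * (Real.sin x.1 - Real.sin y.1)| + 2 * M * dist x y :=
          (abs_sub _ _).trans (add_le_add le_rfl hforce)
      _ ≤ ((m : ℝ) - 2) * dist x y + 2 * M * dist x y := by
          rw [abs_mul, abs_of_pos (by linarith : (0 : ℝ) < (m : ℝ) - 2)]
          gcongr
          · linarith
          · exact hs.trans hx1
      _ = _ := by ring
  · rw [Real.dist_eq]
    simp only [truncatedPolarField]
    rw [← mul_sub, abs_mul, abs_neg, abs_of_pos (by linarith : (0 : ℝ) < (m : ℝ) - 2)]
    calc _ ≤ ((m : ℝ) - 2) * dist x y := by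
          gcongr
          · linarith
          · exact hc.trans hx1
      _ ≤ _ := by nlinarith

lemma norm_truncatedPolarField_le {m : ℕ} (hm : 3 ≤ m) (Z T : ℝ) {t : ℝ} (ht : t ∈ Icc (-T) T)
    (x : ℝ × ℝ) : ‖truncatedPolarField m Z t x‖ ≤ polarBound m Z T := by
  have hm' : (3 : ℝ) ≤ m := by exact_mod_cast hm
  rw [coe_polarBound hm]
  set M := Real.exp ((Z + ((m : ℝ) - 2) * T) / ((m : ℝ) - 1)) with hM
  have hM0 : 0 < M := Real.exp_pos _
  have hforce : polarForcing m t (min x.2 (Z + ((m : ℝ) - 2) * |t|)) ≤ 2 * M := by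
    have h1 := Real.exp_le_exp.2 (truncation_div_le hm (Z := Z) ht x.2)
    have h3 := cosh_rpow_le_one hm t
    have h4 := Real.rpow_pos_of_pos (Real.cosh_pos t) (-(1 / ((m : ℝ) - 1)))
    unfold polarForcing
    calc _ ≤ 2 * M * 1 := by gcongr
      _ = _ := by ring
  have hb : (0 : ℝ) < (m : ℝ) - 2 := by linarith
  rw [Prod.norm_def]
  simp only [truncatedPolarField]
  refine max_le ?_ ?_
  · rw [Real.norm_eq_abs]
    refine (abs_sub _ _).trans (add_le_add ?_ ?_)
    · rw [abs_mul, abs_of_pos hb]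
      exact mul_le_of_le_one_right hb.le (Real.abs_sin_le_one _)
    · rwa [abs_of_pos (polarForcing_pos ..)]
  · rw [Real.norm_eq_abs, abs_mul, abs_neg, abs_of_pos hb]
    have := mul_le_of_le_one_right hb.le (Real.abs_cos_le_one x.1)
    linarith

lemma continuous_polarForcing (m : ℕ) {g : ℝ → ℝ} (hg : Continuous g) :
    Continuous fun t => polarForcing m t (g t) := by
  unfold polarForcing
  have : Continuous fun t : ℝ => Real.cosh t ^ (-(1 / ((m : ℝ) - 1))) :=
    Real.continuous_cosh.rpow_const fun t => Or.inl (Real.cosh_pos t).ne'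
  fun_prop

/-- Since `|z'| ≤ m - 2`, the logarithm of the squared radius grows at most linearly. -/
lemma le_add_mul_abs_of_hasDerivAt_cos {m : ℕ} (hm : 3 ≤ m) {φ z : ℝ → ℝ}
    (hz : ∀ t, HasDerivAt z (-((m : ℝ) - 2) * Real.cos (φ t)) t) (t : ℝ) :
    z t ≤ z 0 + ((m : ℝ) - 2) * |t| := by
  have hm' : (3 : ℝ) ≤ m := by exact_mod_cast hm
  have h := convex_univ.norm_image_sub_le_of_norm_hasDerivWithin_le (C := (m : ℝ) - 2) (f := z)
    (fun x _ => (hz x).hasDerivWithinAt) (fun x _ => by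
      rw [Real.norm_eq_abs, abs_mul, abs_neg, abs_of_pos (by linarith : (0 : ℝ) < (m : ℝ) - 2)]
      exact mul_le_of_le_one_right (by linarith) (Real.abs_cos_le_one _))
    (mem_univ 0) (mem_univ t)
  rw [sub_zero, Real.norm_eq_abs, Real.norm_eq_abs] at h
  linarith [le_abs_self (z t - z 0)]

namespace IsPolarSolution

variable {m : ℕ} {ζ : ℝ} {φ z : ℝ → ℝ}

lemma hasDerivAt_truncatedPolarField (hm : 3 ≤ m) (h : IsPolarSolution m ζ φ z) {Z : ℝ}
    (hZ : ζ ≤ Z) (t : ℝ) :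
    HasDerivAt (fun t => (φ t, z t)) (truncatedPolarField m Z t (φ t, z t)) t := by
  have hle : z t ≤ Z + ((m : ℝ) - 2) * |t| := by
    have := le_add_mul_abs_of_hasDerivAt_cos hm h.logRadius t
    rw [h.logRadius_zero] at this
    linarith
  have := (h.angle t).prodMk (h.logRadius t)
  simpa only [truncatedPolarField, min_eq_left hle] using this

end IsPolarSolution

theorem exists_isPolarSolution {m : ℕ} (hm : 3 ≤ m) (ζ : ℝ) :
    ∃ φ z : ℝ → ℝ, IsPolarSolution m ζ φ z := by
  obtain ⟨α, hα0, hα⟩ := exists_forall_hasDerivAt_of_lipschitzWith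
    (F := truncatedPolarField m ζ) (K := polarBound m ζ) (L := polarBound m ζ)
    (fun T t ht => lipschitzWith_truncatedPolarField hm ζ T ht)
    (fun x => by
      unfold truncatedPolarField
      exact (continuous_const.sub (continuous_polarForcing m (by fun_prop))).prodMk
        continuous_const)
    (fun T t ht x => norm_truncatedPolarField_le hm ζ T ht x) (Real.pi / 2, ζ)
  have h1 : ∀ t, HasDerivAt (fun t => (α t).1) (truncatedPolarField m ζ t (α t)).1 t :=
    fun t => (hα t).fst
  have h2 : ∀ t, HasDerivAt (fun t => (α t).2) (truncatedPolarField m ζ t (α t)).2 t :=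
    fun t => (hα t).snd
  have hle : ∀ t, (α t).2 ≤ ζ + ((m : ℝ) - 2) * |t| := fun t => by
    have := le_add_mul_abs_of_hasDerivAt_cos hm (φ := fun t => (α t).1) h2 t
    rwa [hα0] at this
  refine ⟨fun t => (α t).1, fun t => (α t).2, fun t => ?_, h2, by simp [hα0], by simp [hα0]⟩
  have := h1 t
  simpa only [truncatedPolarField, min_eq_left (hle t)] using this

/-- Solutions of the polar system depend continuously on the initial value at every time `t ≥ 0`,
by Grönwall's inequality. -/
theorem continuous_polarSolution {m : ℕ} (hm : 3 ≤ m) {φ z : ℝ → ℝ → ℝ}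
    (h : ∀ ζ, IsPolarSolution m ζ (φ ζ) (z ζ)) {t : ℝ} (ht : 0 ≤ t) :
    Continuous fun ζ => (φ ζ t, z ζ t) := by
  rw [continuous_iff_continuousAt]
  intro ζ
  set K : ℝ := (polarBound m (ζ + 1) t : ℝ)
  have hdist : ∀ᶠ ξ in 𝓝 ζ, dist (φ ξ t, z ξ t) (φ ζ t, z ζ t) ≤
      dist ξ ζ * Real.exp (K * (t - 0)) := by
    filter_upwards [eventually_le_nhds (show ζ < ζ + 1 by linarith)] with ξ hξ
    have hf := fun s => (h ξ).hasDerivAt_truncatedPolarField hm hξ s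
    have hg := fun s => (h ζ).hasDerivAt_truncatedPolarField hm (show ζ ≤ ζ + 1 by linarith) s
    refine dist_le_of_trajectories_ODE_of_mem (v := truncatedPolarField m (ζ + 1))
      (K := polarBound m (ζ + 1) t) (s := fun _ => univ) (a := 0) (b := t)
      (fun s hs => (lipschitzWith_truncatedPolarField hm _ t
        ⟨by linarith [hs.1], hs.2.le⟩).lipschitzOnWith)
      (f := fun s => (φ ξ s, z ξ s)) (g := fun s => (φ ζ s, z ζ s))
      (fun s _ => (hf s).continuousAt.continuousWithinAt) (fun s _ => (hf s).hasDerivWithinAt)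
      (fun _ _ => mem_univ _)
      (fun s _ => (hg s).continuousAt.continuousWithinAt) (fun s _ => (hg s).hasDerivWithinAt)
      (fun _ _ => mem_univ _) ?_ t (right_mem_Icc.2 ht)
    rw [(h ξ).angle_zero, (h ζ).angle_zero, (h ξ).logRadius_zero, (h ζ).logRadius_zero,
      Prod.dist_eq, dist_self]
    exact max_le dist_nonneg le_rfl
  rw [ContinuousAt, tendsto_iff_dist_tendsto_zero]
  refine squeeze_zero' (Eventually.of_forall fun _ => dist_nonneg) hdist ?_
  have : Continuous fun ξ : ℝ => dist ξ ζ * Real.exp (K * (t - 0)) := by fun_prop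
  simpa using this.tendsto ζ

/-! ### The energy along solutions of the polar system -/

/-- The multiple `4m/(m-1) · H` of the Hamiltonian energy `H`, in polar coordinates. -/
noncomputable def polarEnergy (m : ℕ) (φ z : ℝ → ℝ) (t : ℝ) : ℝ :=
  Real.exp (z t) *
    (polarForcing m t (z t) - (m : ℝ) * ((m : ℝ) - 2) / ((m : ℝ) - 1) * Real.sin (φ t))

/-- The coefficient of the sine in `polarEnergy` is larger than the one in the equation for the
angle. -/
lemma sub_two_lt_energy_coeff {m : ℕ} (hm : 3 ≤ m) :
    (m : ℝ) - 2 < (m : ℝ) * ((m : ℝ) - 2) / ((m : ℝ) - 1) := by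
  have hm' : (3 : ℝ) ≤ m := by exact_mod_cast hm
  rw [lt_div_iff₀ (by linarith)]
  nlinarith

lemma one_half_le_tanh {t : ℝ} (ht : 1 ≤ t) : 1 / 2 ≤ Real.tanh t := by
  rw [Real.tanh_eq_sinh_div_cosh, le_div_iff₀ (Real.cosh_pos t), Real.sinh_eq, Real.cosh_eq]
  have h1 := Real.add_one_le_exp t
  have h2 : Real.exp (-t) ≤ 1 / 2 := by
    rw [Real.exp_neg, inv_le_comm₀ (Real.exp_pos t) (by norm_num)]
    linarith
  linarith

namespace IsPolarSolution

variable {m : ℕ} {ζ : ℝ} {φ z : ℝ → ℝ}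

lemma continuous_angle (h : IsPolarSolution m ζ φ z) : Continuous φ :=
  continuous_iff_continuousAt.2 fun t => (h.angle t).continuousAt

lemma continuous_logRadius (h : IsPolarSolution m ζ φ z) : Continuous z :=
  continuous_iff_continuousAt.2 fun t => (h.logRadius t).continuousAt

lemma hasDerivAt_forcing (h : IsPolarSolution m ζ φ z) (t : ℝ) :
    HasDerivAt (fun t => polarForcing m t (z t))
      (-(1 / ((m : ℝ) - 1)) * polarForcing m t (z t) *
        (((m : ℝ) - 2) * Real.cos (φ t) + Real.tanh t)) t := by
  have h1 := ((h.logRadius t).div_const ((m : ℝ) - 1)).exp.const_mul 2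
  have h2 := (Real.hasDerivAt_cosh t).rpow_const (p := -(1 / ((m : ℝ) - 1)))
    (Or.inl (Real.cosh_pos t).ne')
  refine (h1.mul h2).congr_deriv ?_
  have hc := Real.cosh_pos t
  rw [Real.rpow_sub_one hc.ne', Real.tanh_eq_sinh_div_cosh, polarForcing]
  ring

lemma hasDerivAt_energy (hm : 3 ≤ m) (h : IsPolarSolution m ζ φ z) (t : ℝ) :
    HasDerivAt (polarEnergy m φ z)
      (-(1 / ((m : ℝ) - 1)) * Real.tanh t * polarForcing m t (z t) * Real.exp (z t)) t := by
  have hm' : (3 : ℝ) ≤ m := by exact_mod_cast hm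
  have h1 := (h.logRadius t).exp.mul ((h.hasDerivAt_forcing t).sub
    ((h.angle t).sin.const_mul ((m : ℝ) * ((m : ℝ) - 2) / ((m : ℝ) - 1))))
  refine h1.congr_deriv ?_
  have : (m : ℝ) - 1 ≠ 0 := by linarith
  simp only [Pi.sub_apply]
  field_simp
  ring

lemma exp_logRadius (hm : 3 ≤ m) (z t : ℝ) :
    Real.exp z = (polarForcing m t z / 2) ^ (m - 1) * Real.cosh t := by
  have hm' : (3 : ℝ) ≤ m := by exact_mod_cast hm
  have hcast : ((m - 1 : ℕ) : ℝ) = (m : ℝ) - 1 := by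
    rw [Nat.cast_sub (by omega), Nat.cast_one]
  have hne : (m : ℝ) - 1 ≠ 0 := by linarith
  have h1 : polarForcing m t z / 2 =
      Real.exp (z / ((m : ℝ) - 1)) * Real.cosh t ^ (-(1 / ((m : ℝ) - 1))) := by
    unfold polarForcing
    ring
  rw [h1, mul_pow, ← Real.exp_nat_mul, ← Real.rpow_natCast (Real.cosh t ^ _),
    ← Real.rpow_mul (Real.cosh_pos t).le, hcast]
  have h2 : ((m : ℝ) - 1) * (z / ((m : ℝ) - 1)) = z := by field_simp
  have h3 : -(1 / ((m : ℝ) - 1)) * ((m : ℝ) - 1) = -1 := by field_simp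
  rw [h2, h3, Real.rpow_neg_one, mul_assoc, inv_mul_cancel₀ (Real.cosh_pos t).ne', mul_one]

lemma strictAntiOn_energy (hm : 3 ≤ m) (h : IsPolarSolution m ζ φ z) :
    StrictAntiOn (polarEnergy m φ z) (Ici 0) := by
  have hm' : (3 : ℝ) ≤ m := by exact_mod_cast hm
  refine strictAntiOn_Ici_of_hasDerivAt_neg (h.hasDerivAt_energy hm) fun t ht => ?_
  have h1 : 0 < Real.tanh t := by
    rw [Real.tanh_eq_sinh_div_cosh]
    exact div_pos (Real.sinh_pos_iff.2 ht) (Real.cosh_pos t)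
  have h2 := polarForcing_pos m t (z t)
  have h3 : 0 < 1 / ((m : ℝ) - 1) := one_div_pos.2 (by linarith)
  have := mul_pos (mul_pos (mul_pos h3 h1) h2) (Real.exp_pos (z t))
  linarith

/-- The angle crosses multiples of `π` only downwards, since there `φ' = -Y < 0`. -/
lemma angle_lt_of_le (h : IsPolarSolution m ζ φ z) (n : ℤ) (s t : ℝ) (hst : s < t)
    (hs : φ s ≤ n * Real.pi) : φ t < n * Real.pi := by
  refine lt_of_le_of_deriv_neg_on_level h.angle (fun x hx => ?_) hst hs
  rw [hx, Real.sin_int_mul_pi]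
  have := polarForcing_pos m x (z x)
  linarith

lemma angle_lt_pi (h : IsPolarSolution m ζ φ z) {t : ℝ} (ht : 0 ≤ t) : φ t < Real.pi := by
  have hπ := Real.pi_pos
  rcases ht.eq_or_lt with rfl | ht
  · rw [h.angle_zero]
    linarith
  · have := h.angle_lt_of_le 1 0 t ht (by rw [h.angle_zero]; push_cast; linarith)
    simpa using this

/-- The logarithmic derivative of the forcing is at most `1` in absolute value. -/
lemma abs_forcing_rate_le (hm : 3 ≤ m) (φ t : ℝ) :
    |1 / ((m : ℝ) - 1) * (((m : ℝ) - 2) * Real.cos φ + Real.tanh t)| ≤ 1 := by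
  have hm' : (3 : ℝ) ≤ m := by exact_mod_cast hm
  rw [abs_mul, abs_of_pos (one_div_pos.2 (by linarith)), one_div, inv_mul_le_iff₀ (by linarith)]
  refine (abs_add_le _ _).trans ?_
  have h1 := (Real.abs_tanh_lt_one t).le
  have h2 := mul_le_of_le_one_right (by linarith : (0 : ℝ) ≤ (m : ℝ) - 2)
    (Real.abs_cos_le_one φ)
  rw [abs_mul, abs_of_pos (by linarith : (0 : ℝ) < (m : ℝ) - 2)]
  linarith

lemma antitone_forcing_mul_exp_neg (hm : 3 ≤ m) (h : IsPolarSolution m ζ φ z) :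
    Antitone fun t => polarForcing m t (z t) * Real.exp (-t) := by
  have hd : ∀ t, HasDerivAt (fun t => polarForcing m t (z t) * Real.exp (-t)) _ t := fun t =>
    (h.hasDerivAt_forcing t).mul (hasDerivAt_neg t).exp
  refine antitone_of_hasDerivAt_nonpos hd fun t => ?_
  have h1 := (abs_le.1 (abs_forcing_rate_le hm (φ t) t)).1
  have h2 := mul_pos (polarForcing_pos m t (z t)) (Real.exp_pos (-t))
  simp only [Pi.zero_apply]
  nlinarith

lemma monotone_forcing_mul_exp (hm : 3 ≤ m) (h : IsPolarSolution m ζ φ z) :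
    Monotone fun t => polarForcing m t (z t) * Real.exp t := by
  have hd : ∀ t, HasDerivAt (fun t => polarForcing m t (z t) * Real.exp t) _ t := fun t =>
    (h.hasDerivAt_forcing t).mul (Real.hasDerivAt_exp t)
  refine monotone_of_hasDerivAt_nonneg hd fun t => ?_
  have h1 := (abs_le.1 (abs_forcing_rate_le hm (φ t) t)).2
  have h2 := mul_pos (polarForcing_pos m t (z t)) (Real.exp_pos t)
  simp only [Pi.zero_apply]
  nlinarith

/-- The rate of the energy loss caused by a forcing of size `η`. -/
noncomputable def lossRate (m : ℕ) (η : ℝ) : ℝ :=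
  1 / ((m : ℝ) - 1) * (η * Real.exp (-1)) * (η * Real.exp (-1) / 2) ^ (m - 1)

lemma lossRate_pos (hm : 3 ≤ m) {η : ℝ} (hη : 0 < η) : 0 < lossRate m η := by
  have hm' : (3 : ℝ) ≤ m := by exact_mod_cast hm
  have h3 : 0 < 1 / ((m : ℝ) - 1) := one_div_pos.2 (by linarith)
  unfold lossRate
  positivity

/-- A forcing of size `η` at time `t` persists on `[t - 1, t]` up to a factor `e`, where the squared
radius is comparable to `cosh`; so the energy has dropped by an amount of that order. -/
lemma energy_le_of_le_forcing (hm : 3 ≤ m) (h : IsPolarSolution m ζ φ z) {η t : ℝ} (hη : 0 < η)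
    (ht : 1 ≤ t) (hY : η ≤ polarForcing m t (z t)) :
    polarEnergy m φ z t ≤ polarEnergy m φ z 0 - lossRate m η * Real.sinh (t - 1) := by
  have hm' : (3 : ℝ) ≤ m := by exact_mod_cast hm
  have h0 : polarEnergy m φ z (t - 1) ≤ polarEnergy m φ z 0 :=
    (h.strictAntiOn_energy hm).antitoneOn (mem_Ici.2 le_rfl) (mem_Ici.2 (by linarith))
      (by linarith)
  have hloss : polarEnergy m φ z t - polarEnergy m φ z (t - 1) ≤
      -(lossRate m η * Real.sinh (t - 1)) * (t - (t - 1)) := by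
    refine (convex_Icc (t - 1) t).image_sub_le_mul_sub_of_deriv_le
      (fun s _ => (h.hasDerivAt_energy hm s).continuousAt.continuousWithinAt)
      (fun s _ => (h.hasDerivAt_energy hm s).differentiableAt.differentiableWithinAt)
      (fun s hs => ?_) (t - 1) (left_mem_Icc.2 (by linarith)) t (right_mem_Icc.2 (by linarith))
      (by linarith)
    rw [interior_Icc] at hs
    rw [(h.hasDerivAt_energy hm s).deriv]
    have hYs : η * Real.exp (-1) ≤ polarForcing m s (z s) := by
      have h1 := h.antitone_forcing_mul_exp_neg hm hs.2.le
      simp only at h1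
      calc η * Real.exp (-1) ≤ polarForcing m t (z t) * Real.exp (s - t) := by
            gcongr
            · exact (polarForcing_pos ..).le
            · linarith [hs.1]
        _ = polarForcing m t (z t) * Real.exp (-t) * Real.exp s := by
            rw [mul_assoc, ← Real.exp_add]; ring_nf
        _ ≤ polarForcing m s (z s) * Real.exp (-s) * Real.exp s := by gcongr
        _ = polarForcing m s (z s) := by rw [mul_assoc, ← Real.exp_add]; simp
    have hsinh : Real.sinh (t - 1) ≤ Real.sinh s := Real.sinh_le_sinh.2 hs.1.le
    have hsinh0 : 0 ≤ Real.sinh (t - 1) := Real.sinh_nonneg_iff.2 (by linarith)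
    have hp : 0 < 1 / ((m : ℝ) - 1) := one_div_pos.2 (by linarith)
    have key : lossRate m η * Real.sinh (t - 1) ≤
        1 / ((m : ℝ) - 1) * polarForcing m s (z s) * (polarForcing m s (z s) / 2) ^ (m - 1) *
          Real.sinh s := by
      have := polarForcing_pos m s (z s)
      unfold lossRate
      gcongr
    have heq : -(1 / ((m : ℝ) - 1)) * Real.tanh s * polarForcing m s (z s) * Real.exp (z s) =
        -(1 / ((m : ℝ) - 1) * polarForcing m s (z s) * (polarForcing m s (z s) / 2) ^ (m - 1) *
          Real.sinh s) := by
      rw [exp_logRadius hm (z s) s, Real.tanh_eq_sinh_div_cosh]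
      have := (Real.cosh_pos s).ne'
      field_simp
    rw [heq]
    linarith
  linarith

lemma tendsto_lossRate_mul_sinh (hm : 3 ≤ m) {η : ℝ} (hη : 0 < η) :
    Tendsto (fun t => lossRate m η * Real.sinh (t - 1)) atTop atTop := by
  refine Tendsto.const_mul_atTop (lossRate_pos hm hη) ?_
  have h1 : Tendsto (fun t : ℝ => t - 1) atTop atTop := tendsto_atTop_add_const_right _ _ tendsto_id
  refine tendsto_atTop_mono' _ ?_ h1
  filter_upwards [eventually_ge_atTop 1] with t ht
  exact Real.self_le_sinh_iff.2 (by linarith)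

/-- While the energy is nonnegative, the forcing is small at late times, uniformly over solutions
with bounded initial energy. -/
theorem exists_forcing_lt (hm : 3 ≤ m) (C : ℝ) {η : ℝ} (hη : 0 < η) :
    ∃ T, 0 ≤ T ∧ ∀ {ζ : ℝ} {φ z : ℝ → ℝ}, IsPolarSolution m ζ φ z → polarEnergy m φ z 0 ≤ C →
      ∀ t, T ≤ t → 0 ≤ polarEnergy m φ z t → polarForcing m t (z t) < η := by
  obtain ⟨T, hT⟩ := eventually_atTop.1 ((tendsto_lossRate_mul_sinh hm hη).eventually_gt_atTop C)
  refine ⟨max T 1, by positivity, fun {ζ φ z} h hC t ht hE => ?_⟩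
  by_contra! hY
  have h1 := h.energy_le_of_le_forcing hm hη ((le_max_right _ _).trans ht) hY
  have h2 := hT t ((le_max_left _ _).trans ht)
  linarith

/-! ### The two types of behaviour -/

/-- The energy becomes nonpositive while the angle is in the sector `(-2πk, -2πk + π)`. -/
def IsTrapped (m : ℕ) (φ z : ℝ → ℝ) (k : ℕ) : Prop :=
  ∃ t, 0 ≤ t ∧ polarEnergy m φ z t ≤ 0 ∧ -(2 * Real.pi * k) < φ t ∧
    φ t < -(2 * Real.pi * k) + Real.pi

/-- The energy stays positive for `t ≥ 0` and the angle tends to `-2πk`. -/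
def IsDecaying (m : ℕ) (φ z : ℝ → ℝ) (k : ℕ) : Prop :=
  (∀ t, 0 ≤ t → 0 < polarEnergy m φ z t) ∧ Tendsto φ atTop (𝓝 (-(2 * Real.pi * k)))

lemma sin_pos_of_mem_sector {x : ℝ} {k : ℕ} (h1 : -(2 * Real.pi * k) < x)
    (h2 : x < -(2 * Real.pi * k) + Real.pi) : 0 < Real.sin x := by
  rw [← Real.sin_add_nat_mul_two_pi x k]
  apply Real.sin_pos_of_pos_of_lt_pi <;> linarith

lemma exists_sector_of_sin_pos {x : ℝ} (hx : x < Real.pi) (hs : 0 < Real.sin x) :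
    ∃ k : ℕ, -(2 * Real.pi * k) < x ∧ x < -(2 * Real.pi * k) + Real.pi := by
  have hπ := Real.pi_pos
  set n : ℤ := ⌊x / (2 * Real.pi)⌋ with hn
  have h1 : n * (2 * Real.pi) ≤ x := by
    rw [← le_div_iff₀ (by positivity)]
    exact Int.floor_le _
  have h2 : x < (n + 1) * (2 * Real.pi) := by
    rw [← div_lt_iff₀ (by positivity)]
    exact Int.lt_floor_add_one _
  have hn0 : n ≤ 0 := by
    by_contra! hlt
    have : (1 : ℝ) ≤ n := by exact_mod_cast hlt
    nlinarith
  have hs' : Real.sin (x - n * (2 * Real.pi)) = Real.sin x := Real.sin_sub_int_mul_two_pi x n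
  have hcast : ((n.natAbs : ℕ) : ℝ) = -(n : ℝ) := by
    rw [Nat.cast_natAbs, abs_of_nonpos hn0]
    push_cast
    rfl
  refine ⟨n.natAbs, ?_, ?_⟩ <;> rw [hcast]
  · rcases h1.eq_or_lt with h | h
    · rw [h, sub_self, Real.sin_zero] at hs'
      linarith
    · linarith
  · by_contra! hge
    have h3 : 0 ≤ Real.sin (x - n * (2 * Real.pi) - Real.pi) :=
      Real.sin_nonneg_of_nonneg_of_le_pi (by linarith) (by linarith)
    rw [Real.sin_sub_pi] at h3
    linarith

lemma sin_pos_of_energy_nonpos (hm : 3 ≤ m) {t : ℝ} (hE : polarEnergy m φ z t ≤ 0) :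
    0 < Real.sin (φ t) := by
  have hm' : (3 : ℝ) ≤ m := by exact_mod_cast hm
  have h1 := sub_two_lt_energy_coeff hm
  have h2 := polarForcing_pos m t (z t)
  have h3 : polarForcing m t (z t) -
      (m : ℝ) * ((m : ℝ) - 2) / ((m : ℝ) - 1) * Real.sin (φ t) ≤ 0 :=
    nonpos_of_mul_nonpos_right hE (Real.exp_pos _)
  by_contra! hs
  have := mul_nonpos_of_nonneg_of_nonpos
    (by linarith : 0 ≤ (m : ℝ) * ((m : ℝ) - 2) / ((m : ℝ) - 1)) hs
  linarith

lemma energy_coeff_mul_sin_lt {t : ℝ} (hE : 0 < polarEnergy m φ z t) :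
    (m : ℝ) * ((m : ℝ) - 2) / ((m : ℝ) - 1) * Real.sin (φ t) < polarForcing m t (z t) := by
  have := pos_of_mul_pos_right hE (Real.exp_pos (z t)).le
  linarith

/-- Once the energy is nonpositive, the angle stays in its sector: it cannot leave it upwards, and
on the lower end the energy would be positive. -/
lemma mem_sector_of_energy_nonpos (hm : 3 ≤ m) (h : IsPolarSolution m ζ φ z) {s t : ℝ} {k : ℕ}
    (hs : 0 ≤ s) (hE : polarEnergy m φ z s ≤ 0) (h1 : -(2 * Real.pi * k) < φ s)
    (h2 : φ s < -(2 * Real.pi * k) + Real.pi) (hst : s ≤ t) :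
    polarEnergy m φ z t ≤ 0 ∧ -(2 * Real.pi * k) < φ t ∧ φ t < -(2 * Real.pi * k) + Real.pi := by
  have hanti := (h.strictAntiOn_energy hm).antitoneOn
  have hEt : ∀ x, s ≤ x → polarEnergy m φ z x ≤ 0 := fun x hx =>
    (hanti (mem_Ici.2 hs) (mem_Ici.2 (hs.trans hx)) hx).trans hE
  refine ⟨hEt t hst, ?_, ?_⟩
  · by_contra! hle
    obtain ⟨x, hx, hφx⟩ := intermediate_value_Icc' hst h.continuous_angle.continuousOn
      (show -(2 * Real.pi * k) ∈ Icc (φ t) (φ s) from ⟨hle, h1.le⟩)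
    have hsin := sin_pos_of_energy_nonpos hm (hEt x hx.1)
    rw [hφx, show -(2 * Real.pi * k) = (0 : ℝ) - k * (2 * Real.pi) by ring,
      Real.sin_sub_nat_mul_two_pi, Real.sin_zero] at hsin
    exact lt_irrefl _ hsin
  · rcases hst.eq_or_lt with rfl | hlt
    · exact h2
    · have := h.angle_lt_of_le (-(2 * k) + 1) s t hlt (by push_cast; linarith)
      push_cast at this
      linarith

lemma strictAntiOn_angle (hm : 3 ≤ m) (h : IsPolarSolution m ζ φ z) {T : ℝ}
    (hE : ∀ t, 0 ≤ t → t ≤ T → 0 < polarEnergy m φ z t) : StrictAntiOn φ (Icc 0 T) := by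
  have hm' : (3 : ℝ) ≤ m := by exact_mod_cast hm
  refine strictAntiOn_of_deriv_neg (convex_Icc 0 T)
    h.continuous_angle.continuousOn fun t ht => ?_
  rw [interior_Icc] at ht
  rw [(h.angle t).deriv]
  have h1 := energy_coeff_mul_sin_lt (hE t ht.1.le ht.2.le)
  have h2 := sub_two_lt_energy_coeff hm
  have h3 := polarForcing_pos m t (z t)
  rcases le_or_gt (Real.sin (φ t)) 0 with hs | hs
  · have := mul_nonpos_of_nonneg_of_nonpos (by linarith : 0 ≤ (m : ℝ) - 2) hs
    linarith
  · have := mul_le_mul_of_nonneg_right h2.le hs.le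
    linarith

lemma tendsto_forcing_of_energy_pos (hm : 3 ≤ m) (h : IsPolarSolution m ζ φ z)
    (hE : ∀ t, 0 ≤ t → 0 < polarEnergy m φ z t) :
    Tendsto (fun t => polarForcing m t (z t)) atTop (𝓝 0) := by
  rw [tendsto_order]
  refine ⟨fun a ha => Eventually.of_forall fun t => ha.trans (polarForcing_pos m t (z t)),
    fun a ha => ?_⟩
  obtain ⟨T, hT0, hT⟩ := exists_forcing_lt hm (polarEnergy m φ z 0) ha
  filter_upwards [eventually_ge_atTop T] with t ht
  exact hT h le_rfl t ht (hE t (hT0.trans ht)).le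

lemma energy_coeff_lt_forcing {t : ℝ} {k : ℕ} (hE : 0 < polarEnergy m φ z t)
    (hφ : φ t = -(2 * Real.pi * k) + Real.pi / 2) :
    (m : ℝ) * ((m : ℝ) - 2) / ((m : ℝ) - 1) < polarForcing m t (z t) := by
  have h1 := energy_coeff_mul_sin_lt hE
  rwa [hφ, show -(2 * Real.pi * k) + Real.pi / 2 = Real.pi / 2 - k * (2 * Real.pi) by ring,
    Real.sin_sub_nat_mul_two_pi, Real.sin_pi_div_two, mul_one] at h1

/-- If the angle tended to an odd multiple of `π`, the product `Y e^z` would eventually increase,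
and the energy would tend to `-∞`. -/
lemma cos_ne_neg_one_of_tendsto (hm : 3 ≤ m) (h : IsPolarSolution m ζ φ z)
    (hE : ∀ t, 0 ≤ t → 0 < polarEnergy m φ z t) {l : ℝ} (hl : Tendsto φ atTop (𝓝 l)) :
    Real.cos l ≠ -1 := by
  have hm' : (3 : ℝ) ≤ m := by exact_mod_cast hm
  intro hcos
  have hev : ∀ᶠ t in atTop, Real.cos (φ t) < -(1 / 2) := by
    have := (Real.continuous_cos.tendsto l).comp hl
    rw [hcos] at this
    exact this.eventually_lt_const (by norm_num)
  obtain ⟨a, ha⟩ := eventually_atTop.1 (hev.and (eventually_ge_atTop 1))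
  have ha1 : 1 ≤ a := (ha a le_rfl).2
  set W : ℝ → ℝ := fun t => polarForcing m t (z t) * Real.exp (z t) with hW
  have hW0 : ∀ t, 0 < W t := fun t => mul_pos (polarForcing_pos ..) (Real.exp_pos _)
  have hWd : ∀ t, HasDerivAt (fun t => -W t) _ t := fun t =>
    ((h.hasDerivAt_forcing t).mul (h.logRadius t).exp).neg
  have hp : 0 < 1 / ((m : ℝ) - 1) := one_div_pos.2 (by linarith)
  have hanti : AntitoneOn (fun t => -W t) (Ici a) := by
    refine antitoneOn_Ici_of_hasDerivAt_nonpos hWd fun t ht => ?_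
    have hc := (ha t ht.le).1
    have htanh := (Real.tanh_lt_one t).le
    have hWt := hW0 t
    have hrate : 0 ≤ -(1 / ((m : ℝ) - 1)) * (((m : ℝ) - 2) * Real.cos (φ t) + Real.tanh t) -
        ((m : ℝ) - 2) * Real.cos (φ t) := by
      have h1 : 1 / ((m : ℝ) - 1) ≤ 1 / 2 := one_div_le_one_div_of_le (by norm_num) (by linarith)
      have h2 : ((m : ℝ) - 2) * Real.cos (φ t) ≤ -(1 / 2) := by nlinarith
      nlinarith
    have := mul_nonneg hrate hWt.le
    simp only [hW] at this
    linarith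
  have hbot : Tendsto (polarEnergy m φ z) atTop atBot := by
    refine tendsto_atBot_of_hasDerivAt_le (a := a)
      (δ := 1 / ((m : ℝ) - 1) * (1 / 2) * W a) (by have := hW0 a; positivity)
      (h.hasDerivAt_energy hm) fun t ht => ?_
    have h1 := one_half_le_tanh (ha1.trans ht.le)
    have h2 := hanti (mem_Ici.2 le_rfl) (mem_Ici.2 ht.le) ht.le
    simp only at h2
    have h3 : 1 / ((m : ℝ) - 1) * (1 / 2) * W a ≤ 1 / ((m : ℝ) - 1) * Real.tanh t * W t := by
      have := hW0 a
      gcongr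
      linarith
    simp only [hW] at h3
    linarith
  obtain ⟨t, ht, ht0⟩ := ((hbot.eventually_le_atBot 0).and (eventually_ge_atTop 0)).exists
  exact absurd (hE t ht0) (not_lt.2 ht)

/-- If the energy stays positive, the forcing tends to zero, so that the angle cannot pass
`-2πj + π/2` at late times; being decreasing, it converges, and the limit is a zero of the sine. -/
theorem exists_isDecaying_of_energy_pos (hm : 3 ≤ m) (h : IsPolarSolution m ζ φ z)
    (hE : ∀ t, 0 ≤ t → 0 < polarEnergy m φ z t) : ∃ k, IsDecaying m φ z k := by
  have hm' : (3 : ℝ) ≤ m := by exact_mod_cast hm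
  have hπ := Real.pi_pos
  have hq := sub_two_lt_energy_coeff hm
  have hanti : ∀ s t, 0 ≤ s → s < t → φ t < φ s := fun s t hs hst =>
    h.strictAntiOn_angle hm (T := t) (fun x hx _ => hE x hx) ⟨hs, hst.le⟩
      ⟨hs.trans hst.le, le_rfl⟩ hst
  have hY := h.tendsto_forcing_of_energy_pos hm hE
  obtain ⟨T, hT⟩ := eventually_atTop.1 ((hY.eventually_lt_const
    (show (0 : ℝ) < (m : ℝ) * ((m : ℝ) - 2) / ((m : ℝ) - 1) by linarith)).and
    (eventually_ge_atTop 0))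
  have hT0 : 0 ≤ T := (hT T le_rfl).2
  obtain ⟨j, hj⟩ : ∃ j : ℕ, -(2 * Real.pi * j) + Real.pi / 2 < φ T := by
    obtain ⟨j, hj⟩ := exists_nat_gt ((Real.pi / 2 - φ T) / (2 * Real.pi))
    refine ⟨j, ?_⟩
    rw [div_lt_iff₀ (by positivity)] at hj
    linarith
  have hlow : ∀ t, T ≤ t → -(2 * Real.pi * j) + Real.pi / 2 < φ t := by
    intro t ht
    by_contra! hle
    obtain ⟨x, hx, hφx⟩ := intermediate_value_Icc' ht h.continuous_angle.continuousOn
      ⟨hle, hj.le⟩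
    have h1 := energy_coeff_lt_forcing (hE x (hT0.trans hx.1)) hφx
    have h2 := (hT x hx.1).1
    linarith
  obtain ⟨l, hl⟩ : ∃ l, Tendsto φ atTop (𝓝 l) := by
    have hmono : Antitone fun t => φ (max t T) := fun s t hst => by
      rcases (max_le_max_right T hst).eq_or_lt with heq | hlt
      · simp only [heq, le_refl]
      · exact (hanti _ _ (hT0.trans (le_max_right _ _)) hlt).le
    have hbdd : BddBelow (range fun t => φ (max t T)) :=
      ⟨_, forall_mem_range.2 fun t => (hlow _ (le_max_right t T)).le⟩
    refine ⟨_, (tendsto_atTop_ciInf hmono hbdd).congr' ?_⟩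
    filter_upwards [eventually_ge_atTop T] with t ht
    rw [max_eq_left ht]
  have hlt : ∀ t, 0 ≤ t → l < φ t := fun t ht => by
    refine lt_of_le_of_lt (le_of_tendsto hl ?_) (hanti t (t + 1) ht (by linarith))
    filter_upwards [eventually_gt_atTop (t + 1)] with s hs
    exact (hanti (t + 1) s (by linarith) hs).le
  have hd : Tendsto (fun t => ((m : ℝ) - 2) * Real.sin (φ t) - polarForcing m t (z t)) atTop
      (𝓝 (((m : ℝ) - 2) * Real.sin l)) := by
    have := (((Real.continuous_sin.tendsto l).comp hl).const_mul ((m : ℝ) - 2)).sub hY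
    simpa using this
  have hsin : Real.sin l = 0 := by
    rcases lt_trichotomy (Real.sin l) 0 with hs | hs | hs
    · exfalso
      have hneg : ((m : ℝ) - 2) * Real.sin l < 0 := mul_neg_of_pos_of_neg (by linarith) hs
      obtain ⟨a, ha⟩ := eventually_atTop.1 (hd.eventually_lt_const
        (show ((m : ℝ) - 2) * Real.sin l < ((m : ℝ) - 2) * Real.sin l / 2 by linarith))
      have hbot : Tendsto φ atTop atBot := tendsto_atBot_of_hasDerivAt_le
        (δ := -(((m : ℝ) - 2) * Real.sin l / 2)) (by linarith) h.angle fun t ht => by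
          rw [neg_neg]
          exact (ha t ht.le).le
      exact not_tendsto_nhds_of_tendsto_atBot hbot _ hl
    · exact hs
    · exfalso
      have hpos : 0 < ((m : ℝ) - 2) * Real.sin l := mul_pos (by linarith) hs
      obtain ⟨a, ha⟩ := eventually_atTop.1 (hd.eventually_const_lt hpos)
      have hmono : StrictMonoOn φ (Ici a) := by
        refine strictMonoOn_of_deriv_pos (convex_Ici a) h.continuous_angle.continuousOn
          fun t ht => ?_
        rw [interior_Ici] at ht
        rw [(h.angle t).deriv]
        exact ha t (le_of_lt ht)
      have h1 := hmono (mem_Ici.2 (le_max_left a 0))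
        (mem_Ici.2 ((le_max_left a 0).trans (by linarith))) (lt_add_one (max a 0))
      have h2 := hanti (max a 0) (max a 0 + 1) (le_max_right _ _) (by linarith)
      linarith
  have hcos : Real.cos l = 1 :=
    ((Real.sin_eq_zero_iff_cos_eq).1 hsin).resolve_right (h.cos_ne_neg_one_of_tendsto hm hE hl)
  obtain ⟨n, hn⟩ := (Real.cos_eq_one_iff l).1 hcos
  have hn0 : n ≤ 0 := by
    by_contra! hpos
    have h1 : (1 : ℝ) ≤ n := by exact_mod_cast hpos
    have h2 := hlt 0 le_rfl
    rw [h.angle_zero] at h2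
    nlinarith
  refine ⟨n.natAbs, hE, ?_⟩
  have hcast : ((n.natAbs : ℕ) : ℝ) = -(n : ℝ) := by
    rw [Nat.cast_natAbs, abs_of_nonpos hn0]
    push_cast
    rfl
  rw [hcast, show -(2 * Real.pi * -(n : ℝ)) = n * (2 * Real.pi) by ring, hn]
  exact hl

theorem exists_isTrapped_or_isDecaying (hm : 3 ≤ m) (h : IsPolarSolution m ζ φ z) :
    ∃ k, IsTrapped m φ z k ∨ IsDecaying m φ z k := by
  by_cases hE : ∀ t, 0 ≤ t → 0 < polarEnergy m φ z t
  · obtain ⟨k, hk⟩ := h.exists_isDecaying_of_energy_pos hm hE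
    exact ⟨k, Or.inr hk⟩
  · push Not at hE
    obtain ⟨t, ht, hEt⟩ := hE
    obtain ⟨k, hk1, hk2⟩ := exists_sector_of_sin_pos (h.angle_lt_pi ht)
      (sin_pos_of_energy_nonpos hm hEt)
    exact ⟨k, Or.inl ⟨t, ht, hEt, hk1, hk2⟩⟩

lemma IsDecaying.angle_gt (hm : 3 ≤ m) (h : IsPolarSolution m ζ φ z) {k : ℕ}
    (hk : IsDecaying m φ z k) {t : ℝ} (ht : 0 ≤ t) : -(2 * Real.pi * k) < φ t := by
  have hanti : ∀ s t, 0 ≤ s → s < t → φ t < φ s := fun s t hs hst =>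
    h.strictAntiOn_angle hm (T := t) (fun x hx _ => hk.1 x hx) ⟨hs, hst.le⟩
      ⟨hs.trans hst.le, le_rfl⟩ hst
  refine lt_of_le_of_lt (le_of_tendsto hk.2 ?_) (hanti t (t + 1) ht (by linarith))
  filter_upwards [eventually_gt_atTop (t + 1)] with s hs
  exact (hanti (t + 1) s (by linarith) hs).le

lemma IsTrapped.angle_gt (hm : 3 ≤ m) (h : IsPolarSolution m ζ φ z) {k : ℕ}
    (hk : IsTrapped m φ z k) (t : ℝ) : -(2 * Real.pi * k) < φ t := by
  obtain ⟨s, hs, hE, h1, h2⟩ := hk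
  rcases le_or_gt s t with hst | hst
  · exact (h.mem_sector_of_energy_nonpos hm hs hE h1 h2 hst).2.1
  · by_contra! hle
    have := h.angle_lt_of_le (-(2 * k)) t s hst (by push_cast; linarith)
    push_cast at this
    linarith

end IsPolarSolution

/-! ### Asymptotics of the squared radius -/

namespace IsPolarSolution

variable {m : ℕ} {ζ : ℝ} {φ z : ℝ → ℝ}

/-- For decaying solutions the forcing controls the angle, `0 < sin φ < Y`, and decays
exponentially, so that `z + (m-2) t + (m-2) Y²` is eventually decreasing. -/
theorem IsDecaying.exists_logRadius_le (hm : 3 ≤ m) (h : IsPolarSolution m ζ φ z) {k : ℕ}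
    (hk : IsDecaying m φ z k) : ∃ C, ∀ᶠ t in atTop, z t ≤ C - ((m : ℝ) - 2) * t := by
  have hm' : (3 : ℝ) ≤ m := by exact_mod_cast hm
  have hπ := Real.pi_pos
  have hp : 0 < 1 / ((m : ℝ) - 1) := one_div_pos.2 (by linarith)
  have hcos : ∀ᶠ t in atTop, 1 / 2 < Real.cos (φ t) := by
    have := (Real.continuous_cos.tendsto _).comp hk.2
    rw [show -(2 * Real.pi * k) = (0 : ℝ) - k * (2 * Real.pi) by ring,
      Real.cos_sub_nat_mul_two_pi, Real.cos_zero] at this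
    exact this.eventually_const_lt (by norm_num)
  have hup : ∀ᶠ t in atTop, φ t < -(2 * Real.pi * k) + Real.pi :=
    hk.2.eventually_lt_const (by linarith)
  obtain ⟨a, ha⟩ := eventually_atTop.1 (hcos.and (hup.and (eventually_ge_atTop 1)))
  set g : ℝ → ℝ := fun t => z t + ((m : ℝ) - 2) * t +
    ((m : ℝ) - 2) * (polarForcing m t (z t) * polarForcing m t (z t)) with hg
  have hgd : ∀ t, HasDerivAt g _ t := fun t =>
    ((h.logRadius t).add ((hasDerivAt_id t).const_mul ((m : ℝ) - 2))).add
      (((h.hasDerivAt_forcing t).mul (h.hasDerivAt_forcing t)).const_mul ((m : ℝ) - 2))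
  have hanti : AntitoneOn g (Ici a) := by
    refine antitoneOn_Ici_of_hasDerivAt_nonpos hgd fun t ht => ?_
    obtain ⟨hc, hu, h1⟩ := ha t ht.le
    have hlow := IsDecaying.angle_gt hm h hk (by linarith : 0 ≤ t)
    have hsin := sin_pos_of_mem_sector hlow hu
    have hE := energy_coeff_mul_sin_lt (hk.1 t (by linarith))
    have hq := sub_two_lt_energy_coeff hm
    have htanh := one_half_le_tanh h1
    have hY := polarForcing_pos m t (z t)
    set Y := polarForcing m t (z t)
    have hsY : Real.sin (φ t) ≤ Y := by nlinarith
    have hcY : 1 - Real.cos (φ t) ≤ Y * Y := by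
      have h2 := Real.sin_sq_add_cos_sq (φ t)
      have h3 := Real.cos_le_one (φ t)
      nlinarith
    have hrate : 1 / 2 ≤ 1 / ((m : ℝ) - 1) *
        (((m : ℝ) - 2) * Real.cos (φ t) + Real.tanh t) := by
      rw [one_div_mul_eq_div, le_div_iff₀ (by linarith)]
      nlinarith
    have hY' : 2 * (-(1 / ((m : ℝ) - 1)) * Y * (((m : ℝ) - 2) * Real.cos (φ t) + Real.tanh t) * Y) ≤
        -(Y * Y) := by
      nlinarith [mul_pos hY hY]
    have hb : (0 : ℝ) ≤ (m : ℝ) - 2 := by linarith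
    have h4 := mul_le_mul_of_nonneg_left hcY hb
    have h5 := mul_le_mul_of_nonneg_left hY' hb
    linarith
  refine ⟨g a, ?_⟩
  filter_upwards [eventually_ge_atTop a] with t ht
  have h1 := hanti (mem_Ici.2 le_rfl) (mem_Ici.2 ht) ht
  have h2 : 0 ≤ ((m : ℝ) - 2) * (polarForcing m t (z t) * polarForcing m t (z t)) :=
    mul_nonneg (by linarith) (mul_self_nonneg _)
  have h3 : g t = z t + ((m : ℝ) - 2) * t +
    ((m : ℝ) - 2) * (polarForcing m t (z t) * polarForcing m t (z t)) := rfl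
  linarith

lemma IsTrapped.eventually_energy_le (hm : 3 ≤ m) (h : IsPolarSolution m ζ φ z) {k : ℕ}
    (hk : IsTrapped m φ z k) : ∃ δ a, 0 < δ ∧ 0 ≤ a ∧ ∀ t, a ≤ t → polarEnergy m φ z t ≤ -δ := by
  obtain ⟨s, hs, hE, -, -⟩ := hk
  have hanti := h.strictAntiOn_energy hm
  have hlt := hanti (mem_Ici.2 hs) (mem_Ici.2 (by linarith : 0 ≤ s + 1)) (by linarith)
  refine ⟨-polarEnergy m φ z (s + 1), s + 1, by linarith, by linarith, fun t ht => ?_⟩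
  rw [neg_neg]
  exact hanti.antitoneOn (mem_Ici.2 (by linarith)) (mem_Ici.2 (by linarith)) ht

lemma forcing_le_of_energy_nonpos (hm : 3 ≤ m) {t : ℝ} (hE : polarEnergy m φ z t ≤ 0) :
    polarForcing m t (z t) ≤ (m : ℝ) * ((m : ℝ) - 2) / ((m : ℝ) - 1) := by
  have hm' : (3 : ℝ) ≤ m := by exact_mod_cast hm
  have hq := sub_two_lt_energy_coeff hm
  have h3 : polarForcing m t (z t) -
      (m : ℝ) * ((m : ℝ) - 2) / ((m : ℝ) - 1) * Real.sin (φ t) ≤ 0 :=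
    nonpos_of_mul_nonpos_right hE (Real.exp_pos _)
  have := mul_le_of_le_one_right
    (by linarith : 0 ≤ (m : ℝ) * ((m : ℝ) - 2) / ((m : ℝ) - 1)) (Real.sin_le_one (φ t))
  linarith

theorem IsTrapped.exists_exp_logRadius_le (hm : 3 ≤ m) (h : IsPolarSolution m ζ φ z) {k : ℕ}
    (hk : IsTrapped m φ z k) : ∃ C, ∀ᶠ t in atTop, Real.exp (z t) ≤ C * Real.cosh t := by
  obtain ⟨δ, a, hδ, ha, hE⟩ := IsTrapped.eventually_energy_le hm h hk
  refine ⟨((m : ℝ) * ((m : ℝ) - 2) / ((m : ℝ) - 1) / 2) ^ (m - 1), ?_⟩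
  filter_upwards [eventually_ge_atTop a] with t ht
  rw [exp_logRadius hm (z t) t]
  have h1 := forcing_le_of_energy_nonpos hm ((hE t ht).trans (by linarith))
  have h2 := polarForcing_pos m t (z t)
  have h3 := Real.cosh_pos t
  gcongr

/-- If the forcing is not eventually small, the energy tends to `-∞`, which forces the radius to
infinity. Otherwise `v² - u² = -e^z cos φ` has a derivative bounded below by a positive constant. -/
theorem IsTrapped.tendsto_exp_logRadius (hm : 3 ≤ m) (h : IsPolarSolution m ζ φ z) {k : ℕ}
    (hk : IsTrapped m φ z k) : Tendsto (fun t => Real.exp (z t)) atTop atTop := by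
  have hm' : (3 : ℝ) ≤ m := by exact_mod_cast hm
  obtain ⟨δ, a, hδ, ha, hE⟩ := IsTrapped.eventually_energy_le hm h hk
  have hanti := (h.strictAntiOn_energy hm).antitoneOn
  set q := (m : ℝ) * ((m : ℝ) - 2) / ((m : ℝ) - 1) with hq_def
  have hq : (m : ℝ) - 2 < q := sub_two_lt_energy_coeff hm
  have hq0 : 0 < q := by linarith
  have hlow : ∀ t, -polarEnergy m φ z t / q ≤ Real.exp (z t) := fun t => by
    rw [div_le_iff₀ hq0]
    have h1 := mul_pos (Real.exp_pos (z t)) (polarForcing_pos m t (z t))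
    have h2 := mul_le_mul_of_nonneg_left (Real.sin_le_one (φ t))
      (mul_pos (Real.exp_pos (z t)) hq0).le
    have h3 : polarEnergy m φ z t =
      Real.exp (z t) * (polarForcing m t (z t) - q * Real.sin (φ t)) := rfl
    rw [h3]
    linarith
  have hb : (0 : ℝ) < ((m : ℝ) - 2) / 2 := by linarith
  by_cases hfreq : ∃ᶠ t in atTop, ((m : ℝ) - 2) / 2 ≤ polarForcing m t (z t)
  · have hbot : Tendsto (polarEnergy m φ z) atTop atBot := by
      rw [tendsto_atBot]
      intro c
      obtain ⟨s, hsY, hs1, hs⟩ := (hfreq.and_eventually ((eventually_ge_atTop 1).and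
        ((tendsto_lossRate_mul_sinh hm hb).eventually_ge_atTop
          (polarEnergy m φ z 0 - c)))).exists
      have h1 := h.energy_le_of_le_forcing hm hb hs1 hsY
      filter_upwards [eventually_ge_atTop s] with t ht
      have h2 := hanti (mem_Ici.2 (by linarith)) (mem_Ici.2 (by linarith)) ht
      linarith
    exact tendsto_atTop_mono hlow ((tendsto_neg_atBot_atTop.comp hbot).atTop_div_const hq0)
  · rw [not_frequently] at hfreq
    obtain ⟨c, hc⟩ := eventually_atTop.1 (hfreq.and (eventually_ge_atTop a))
    have hd : ∀ t, HasDerivAt (fun t => Real.exp (z t) * Real.cos (φ t))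
        (-(Real.exp (z t) * (((m : ℝ) - 2) - polarForcing m t (z t) * Real.sin (φ t)))) t :=
      fun t => ((h.logRadius t).exp.mul (h.angle t).cos).congr_deriv (by
        have := Real.sin_sq_add_cos_sq (φ t)
        linear_combination (-(Real.exp (z t) * ((m : ℝ) - 2))) * this)
    have hbot : Tendsto (fun t => Real.exp (z t) * Real.cos (φ t)) atTop atBot := by
      refine tendsto_atBot_of_hasDerivAt_le (a := c) (δ := δ / q * (((m : ℝ) - 2) / 2))
        (by positivity) hd fun t ht => ?_
      obtain ⟨h1, h2⟩ := hc t ht.le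
      rw [not_le] at h1
      have h3 : δ / q ≤ Real.exp (z t) := by
        refine le_trans ?_ (hlow t)
        gcongr
        linarith [hE t h2]
      have h4 : polarForcing m t (z t) * Real.sin (φ t) ≤ polarForcing m t (z t) :=
        mul_le_of_le_one_right (polarForcing_pos ..).le (Real.sin_le_one _)
      have h5 : δ / q * (((m : ℝ) - 2) / 2) ≤
          Real.exp (z t) * (((m : ℝ) - 2) - polarForcing m t (z t) * Real.sin (φ t)) := by
        gcongr
        linarith
      linarith
    refine tendsto_atTop_mono (fun t => ?_) (tendsto_neg_atBot_atTop.comp hbot)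
    have := mul_le_mul_of_nonneg_left (Real.neg_one_le_cos (φ t)) (Real.exp_pos (z t)).le
    simp only [Function.comp]
    linarith

/-! ### Dependence of the type on the initial value -/

/-- A large initial value makes the angle turn many times before time `1`. -/
theorem angle_one_le (hm : 3 ≤ m) (h : IsPolarSolution m ζ φ z) :
    φ 1 ≤ Real.pi / 2 + ((m : ℝ) - 2) -
      2 * Real.exp (ζ / ((m : ℝ) - 1)) * Real.exp (-1) := by
  have hm' : (3 : ℝ) ≤ m := by exact_mod_cast hm
  have h0 : polarForcing m 0 (z 0) = 2 * Real.exp (ζ / ((m : ℝ) - 1)) := by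
    simp [polarForcing, h.logRadius_zero]
  have hle := (convex_Icc (0 : ℝ) 1).image_sub_le_mul_sub_of_deriv_le
    (C := ((m : ℝ) - 2) - 2 * Real.exp (ζ / ((m : ℝ) - 1)) * Real.exp (-1))
    h.continuous_angle.continuousOn
    (fun s _ => (h.angle s).differentiableAt.differentiableWithinAt)
    (fun s hs => by
      rw [interior_Icc] at hs
      rw [(h.angle s).deriv]
      have h1 := h.monotone_forcing_mul_exp hm hs.1.le
      simp only [h0, Real.exp_zero, mul_one] at h1
      have h2 : 2 * Real.exp (ζ / ((m : ℝ) - 1)) * Real.exp (-1) ≤ polarForcing m s (z s) :=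
        calc _ ≤ 2 * Real.exp (ζ / ((m : ℝ) - 1)) * Real.exp (-s) := by
              gcongr
              exact hs.2.le
          _ ≤ polarForcing m s (z s) * Real.exp s * Real.exp (-s) := by gcongr
          _ = _ := by rw [mul_assoc, ← Real.exp_add]; simp
      have h3 := mul_le_of_le_one_right (by linarith : (0 : ℝ) ≤ (m : ℝ) - 2)
        (Real.sin_le_one (φ s))
      linarith)
    0 (by simp) 1 (by simp) (by norm_num)
  rw [h.angle_zero] at hle
  linarith

lemma energy_zero (h : IsPolarSolution m ζ φ z) : polarEnergy m φ z 0 =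
    Real.exp ζ * (2 * Real.exp (ζ / ((m : ℝ) - 1)) -
      (m : ℝ) * ((m : ℝ) - 2) / ((m : ℝ) - 1)) := by
  simp [polarEnergy, polarForcing, h.logRadius_zero, h.angle_zero]

end IsPolarSolution

section Family

variable {m : ℕ} {φ z : ℝ → ℝ → ℝ}

open IsPolarSolution

lemma continuous_polarEnergy_family (hm : 3 ≤ m) (h : ∀ ζ, IsPolarSolution m ζ (φ ζ) (z ζ)) {t : ℝ}
    (ht : 0 ≤ t) : Continuous fun ζ => polarEnergy m (φ ζ) (z ζ) t := by
  have h1 := continuous_polarSolution hm h ht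
  have hφ : Continuous fun ζ => φ ζ t := h1.fst
  have hz : Continuous fun ζ => z ζ t := h1.snd
  unfold polarEnergy polarForcing
  fun_prop

theorem eventually_isTrapped (hm : 3 ≤ m) (h : ∀ ζ, IsPolarSolution m ζ (φ ζ) (z ζ)) {ζ : ℝ}
    {k : ℕ} (hk : IsTrapped m (φ ζ) (z ζ) k) :
    ∀ᶠ ξ in 𝓝 ζ, IsTrapped m (φ ξ) (z ξ) k := by
  obtain ⟨s, hs, hE, h1, h2⟩ := hk
  have hlt : polarEnergy m (φ ζ) (z ζ) (s + 1) < 0 :=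
    ((h ζ).strictAntiOn_energy hm (mem_Ici.2 hs) (mem_Ici.2 (by linarith))
      (by linarith)).trans_le hE
  obtain ⟨-, h3, h4⟩ := (h ζ).mem_sector_of_energy_nonpos hm hs hE h1 h2
    (by linarith : s ≤ s + 1)
  have hφ : Continuous fun ζ => φ ζ (s + 1) :=
    (continuous_polarSolution hm h (by linarith : 0 ≤ s + 1)).fst
  have hEc := continuous_polarEnergy_family hm h (by linarith : 0 ≤ s + 1)
  filter_upwards [(hEc.tendsto ζ).eventually_lt_const hlt, (hφ.tendsto ζ).eventually_const_lt h3,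
    (hφ.tendsto ζ).eventually_lt_const h4] with ξ hξ1 hξ2 hξ3
  exact ⟨s + 1, by linarith, hξ1.le, hξ2, hξ3⟩

/-- Near a decaying solution the angle can turn at most once more: passing `-2πk - 3π/2` with
positive energy needs a forcing bounded below, at a time that is late by continuous dependence. -/
theorem eventually_of_isDecaying (hm : 3 ≤ m) (h : ∀ ζ, IsPolarSolution m ζ (φ ζ) (z ζ)) {ζ : ℝ}
    {k : ℕ} (hk : IsDecaying m (φ ζ) (z ζ) k) :
    ∀ᶠ ξ in 𝓝 ζ, IsTrapped m (φ ξ) (z ξ) k ∨ IsDecaying m (φ ξ) (z ξ) k ∨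
      IsTrapped m (φ ξ) (z ξ) (k + 1) := by
  have hm' : (3 : ℝ) ≤ m := by exact_mod_cast hm
  have hπ := Real.pi_pos
  have hq0 : 0 < (m : ℝ) * ((m : ℝ) - 2) / ((m : ℝ) - 1) := by
    have := sub_two_lt_energy_coeff hm
    linarith
  obtain ⟨T₀, hT₀, hlate⟩ := exists_forcing_lt hm (polarEnergy m (φ ζ) (z ζ) 0 + 1) hq0
  obtain ⟨T, hTφ, hTT⟩ := ((hk.2.eventually_lt_const
    (show -(2 * Real.pi * k) < -(2 * Real.pi * k) + Real.pi by linarith)).and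
    (eventually_ge_atTop T₀)).exists
  have hT : 0 ≤ T := hT₀.trans hTT
  have hφ : Continuous fun ζ => φ ζ T := (continuous_polarSolution hm h hT).fst
  have hE0 := continuous_polarEnergy_family hm h le_rfl
  have hET := continuous_polarEnergy_family hm h hT
  filter_upwards [(hE0.tendsto ζ).eventually_lt_const
      (show polarEnergy m (φ ζ) (z ζ) 0 < polarEnergy m (φ ζ) (z ζ) 0 + 1 by linarith),
    (hET.tendsto ζ).eventually_const_lt (hk.1 T hT),
    (hφ.tendsto ζ).eventually_const_lt (IsDecaying.angle_gt hm (h ζ) hk hT),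
    (hφ.tendsto ζ).eventually_lt_const hTφ] with ξ hξ0 hξT hξl hξu
  have hlow : ∀ s, T ≤ s → φ ξ s = -(2 * Real.pi * (k + 1 : ℕ)) + Real.pi / 2 →
      polarEnergy m (φ ξ) (z ξ) s ≤ 0 := by
    intro s hs hφs
    by_contra! hEs
    have h1 := energy_coeff_lt_forcing hEs hφs
    have h2 := hlate (h ξ) hξ0.le s (hTT.trans hs) hEs.le
    linarith
  obtain ⟨j, hj | hj⟩ := (h ξ).exists_isTrapped_or_isDecaying hm
  · obtain ⟨s, hs, hEs, hs1, hs2⟩ := id hj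
    have hTs : T < s := by
      by_contra! hle
      have := (h ξ).strictAntiOn_energy hm |>.antitoneOn (mem_Ici.2 hs) (mem_Ici.2 hT) hle
      linarith
    have hjk : k ≤ j := by
      have h1 := (h ξ).angle_lt_of_le (-(2 * k) + 1) T s hTs (by push_cast; linarith)
      push_cast at h1
      by_contra! hlt
      have h2 : (j : ℝ) + 1 ≤ k := by exact_mod_cast hlt
      nlinarith
    have hjk' : j ≤ k + 1 := by
      by_contra! hlt
      have h2 : (k : ℝ) + 2 ≤ j := by exact_mod_cast hlt
      obtain ⟨x, hx, hφx⟩ := intermediate_value_Icc' hTs.le (h ξ).continuous_angle.continuousOn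
        (show -(2 * Real.pi * (k + 1 : ℕ)) + Real.pi / 2 ∈ Icc (φ ξ s) (φ ξ T) by
          push_cast
          constructor <;> nlinarith)
      have h3 := ((h ξ).mem_sector_of_energy_nonpos hm (k := k + 1) (hT.trans hx.1)
        (hlow x hx.1 hφx) (by rw [hφx]; linarith) (by rw [hφx]; linarith) hx.2).2.1
      push_cast at h3
      nlinarith
    rcases hjk.eq_or_lt with rfl | hlt
    · exact Or.inl hj
    · obtain rfl : j = k + 1 := by omega
      exact Or.inr (Or.inr hj)
  · have hjk : k ≤ j := by
      have h1 := IsDecaying.angle_gt hm (h ξ) hj hT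
      by_contra! hlt
      have h2 : (j : ℝ) + 1 ≤ k := by exact_mod_cast hlt
      nlinarith
    have hjk' : j ≤ k := by
      by_contra! hlt
      have h2 : (k : ℝ) + 1 ≤ j := by exact_mod_cast hlt
      obtain ⟨s, hsφ, hs⟩ := ((hj.2.eventually_lt_const
        (show -(2 * Real.pi * j) < -(2 * Real.pi * (k + 1 : ℕ)) + Real.pi / 2 by
          push_cast; nlinarith)).and (eventually_ge_atTop T)).exists
      obtain ⟨x, hx, hφx⟩ := intermediate_value_Icc' hs (h ξ).continuous_angle.continuousOn
        (show -(2 * Real.pi * (k + 1 : ℕ)) + Real.pi / 2 ∈ Icc (φ ξ s) (φ ξ T) from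
          ⟨hsφ.le, by push_cast; nlinarith⟩)
      exact absurd (hj.1 x (hT.trans hx.1)) (not_lt.2 (hlow x hx.1 hφx))
    obtain rfl : j = k := by omega
    exact Or.inr (Or.inl hj)

/-- Small initial values are trapped at once in the first sector. -/
theorem exists_isTrapped_zero (hm : 3 ≤ m) (h : ∀ ζ, IsPolarSolution m ζ (φ ζ) (z ζ)) :
    ∃ ζ, IsTrapped m (φ ζ) (z ζ) 0 := by
  have hm' : (3 : ℝ) ≤ m := by exact_mod_cast hm
  have hπ := Real.pi_pos
  have hq := sub_two_lt_energy_coeff hm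
  refine ⟨((m : ℝ) - 1) * Real.log ((1 : ℝ) / 2), 0, le_rfl, ?_, ?_, ?_⟩
  · rw [(h _).energy_zero, mul_div_cancel_left₀ _ (by linarith), Real.exp_log (by norm_num)]
    apply mul_nonpos_of_nonneg_of_nonpos (Real.exp_pos _).le
    linarith
  · rw [(h _).angle_zero]
    push_cast
    linarith
  · rw [(h _).angle_zero]
    push_cast
    linarith

/-- For given `k`, a trapped or decaying solution of index `k` has a bounded initial value. -/
theorem exists_forall_le_of_index (hm : 3 ≤ m) (h : ∀ ζ, IsPolarSolution m ζ (φ ζ) (z ζ)) (k : ℕ) :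
    ∃ C, ∀ ζ, IsTrapped m (φ ζ) (z ζ) k ∨ IsDecaying m (φ ζ) (z ζ) k → ζ ≤ C := by
  have hm' : (3 : ℝ) ≤ m := by exact_mod_cast hm
  have hlim : Tendsto (fun ζ : ℝ => 2 * Real.exp (ζ / ((m : ℝ) - 1)) * Real.exp (-1)) atTop
      atTop :=
    (((Real.tendsto_exp_atTop.comp (tendsto_id.atTop_div_const (by linarith))).const_mul_atTop
      (by norm_num : (0 : ℝ) < 2)).atTop_mul_const (Real.exp_pos _))
  obtain ⟨C, hC⟩ := eventually_atTop.1 (hlim.eventually_ge_atTop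
    (Real.pi / 2 + ((m : ℝ) - 2) + 2 * Real.pi * k))
  refine ⟨C, fun ζ hζ => ?_⟩
  by_contra! hlt
  have h1 := (h ζ).angle_one_le hm
  have h2 := hC ζ hlt.le
  have h3 : -(2 * Real.pi * k) < φ ζ 1 := by
    rcases hζ with hk | hk
    · exact IsTrapped.angle_gt hm (h ζ) hk 1
    · exact IsDecaying.angle_gt hm (h ζ) hk zero_le_one
  linarith

end Family

/-! ### Uniqueness and symmetry of the original system -/

namespace IsDissipativeSolution

variable {m : ℕ} {μ : ℝ} {u v : ℝ → ℝ}

/-- The squared radius satisfies `|(u² + v²)'| ≤ (m-2) (u² + v²)`, so it stays positive. -/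
lemma radius_pos (hm : 3 ≤ m) (hμ : 0 < μ) (h : IsDissipativeSolution m μ u v) (t : ℝ) :
    0 < u t ^ 2 + v t ^ 2 := by
  have hm' : (3 : ℝ) ≤ m := by exact_mod_cast hm
  have hr : ∀ t, HasDerivAt (fun t => u t ^ 2 + v t ^ 2)
      (((m : ℝ) - 2) * (v t ^ 2 - u t ^ 2)) t := fun t => by
    have h1 := (h.differentiable_fst t).hasDerivAt.pow 2
    have h2 := (h.differentiable_snd t).hasDerivAt.pow 2
    refine (h1.add h2).congr_deriv ?_
    have h3 := h.eq_fst t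
    have h4 := h.eq_snd t
    simp only [Nat.add_one_sub_one, pow_one, Nat.cast_ofNat]
    linear_combination 2 * u t * h3 - 2 * v t * h4
  have hr0 : 0 < u 0 ^ 2 + v 0 ^ 2 := by
    rw [h.init_fst, h.init_snd]
    positivity
  rcases le_total 0 t with ht | ht
  · have hmono : Monotone fun t => (u t ^ 2 + v t ^ 2) * Real.exp (((m : ℝ) - 2) * t) :=
      monotone_of_hasDerivAt_nonneg (fun t => (hr t).mul
        ((hasDerivAt_id t).const_mul ((m : ℝ) - 2)).exp) fun t => by
          have h1 : 0 ≤ 2 * (((m : ℝ) - 2) * v t ^ 2 * Real.exp (((m : ℝ) - 2) * t)) := by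
            have : (0 : ℝ) ≤ (m : ℝ) - 2 := by linarith
            positivity
          simp only [Pi.zero_apply, id, mul_one]
          linarith
    have h1 := hmono ht
    simp only [mul_zero, Real.exp_zero, mul_one] at h1
    exact pos_of_mul_pos_left (hr0.trans_le h1) (Real.exp_pos _).le
  · have hanti : Antitone fun t => (u t ^ 2 + v t ^ 2) * Real.exp (-((m : ℝ) - 2) * t) :=
      antitone_of_hasDerivAt_nonpos (fun t => (hr t).mul
        ((hasDerivAt_id t).const_mul (-((m : ℝ) - 2))).exp) fun t => by
          have h1 : 0 ≤ 2 * (((m : ℝ) - 2) * u t ^ 2 * Real.exp (-((m : ℝ) - 2) * t)) := by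
            have : (0 : ℝ) ≤ (m : ℝ) - 2 := by linarith
            positivity
          simp only [Pi.zero_apply, id, mul_one]
          linarith
    have h1 := hanti ht
    simp only [mul_zero, Real.exp_zero, mul_one] at h1
    exact pos_of_mul_pos_left (hr0.trans_le h1) (Real.exp_pos _).le

/-- The vector field of the system. -/
noncomputable def field (m : ℕ) (t : ℝ) (x : ℝ × ℝ) : ℝ × ℝ :=
  (Real.cosh t ^ (-(1 / ((m : ℝ) - 1))) * (x.1 ^ 2 + x.2 ^ 2) ^ (1 / ((m : ℝ) - 1)) * x.2 -
      ((m : ℝ) - 2) / 2 * x.1,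
    ((m : ℝ) - 2) / 2 * x.2 -
      Real.cosh t ^ (-(1 / ((m : ℝ) - 1))) * (x.1 ^ 2 + x.2 ^ 2) ^ (1 / ((m : ℝ) - 1)) * x.1)

lemma hasDerivAt_field (h : IsDissipativeSolution m μ u v) (t : ℝ) :
    HasDerivAt (fun t => (u t, v t)) (field m t (u t, v t)) t := by
  have h1 := (h.differentiable_fst t).hasDerivAt
  have h2 := (h.differentiable_snd t).hasDerivAt
  refine (h1.prodMk h2).congr_deriv ?_
  have h3 := h.eq_fst t
  have h4 := h.eq_snd t
  simp only [field, Prod.mk.injEq]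
  constructor <;> linarith

lemma exists_lipschitzOnWith_field (m : ℕ) (t₀ : ℝ) {x₀ : ℝ × ℝ} (hx : 0 < x₀.1 ^ 2 + x₀.2 ^ 2) :
    ∃ K : NNReal, ∃ s ∈ 𝓝 x₀, ∀ᶠ t in 𝓝 t₀, LipschitzOnWith K (field m t) s := by
  have hsmooth : ContDiffAt ℝ 1 (fun y : ℝ × (ℝ × ℝ) => field m y.1 y.2) (t₀, x₀) := by
    have hc : ContDiffAt ℝ 1
        (fun y : ℝ × (ℝ × ℝ) => Real.cosh y.1 ^ (-(1 / ((m : ℝ) - 1)))) (t₀, x₀) :=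
      ContDiffAt.rpow_const_of_ne (Real.contDiff_cosh.contDiffAt.comp _ contDiffAt_fst)
        (Real.cosh_pos _).ne'
    have hr : ContDiffAt ℝ 1
        (fun y : ℝ × (ℝ × ℝ) => (y.2.1 ^ 2 + y.2.2 ^ 2) ^ (1 / ((m : ℝ) - 1))) (t₀, x₀) :=
      ContDiffAt.rpow_const_of_ne (by fun_prop) hx.ne'
    unfold field
    fun_prop
  obtain ⟨K, S, hS, hlip⟩ := hsmooth.exists_lipschitzOnWith
  obtain ⟨I, hI, s, hs, hsub⟩ := mem_nhds_prod_iff.1 hS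
  refine ⟨K, s, hs, ?_⟩
  filter_upwards [hI] with t ht
  refine LipschitzOnWith.of_dist_le_mul fun x hx y hy => ?_
  have := hlip.dist_le_mul (t, x) (hsub ⟨ht, hx⟩) (t, y) (hsub ⟨ht, hy⟩)
  rwa [dist_prod_same_left] at this

/-- Uniqueness: trajectories avoid the origin, away from which the field is smooth, so the set of
times at which two solutions agree is open and closed. -/
theorem unique (hm : 3 ≤ m) (hμ : 0 < μ) {u' v' : ℝ → ℝ} (h : IsDissipativeSolution m μ u v)
    (h' : IsDissipativeSolution m μ u' v') : u' = u ∧ v' = v := by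
  set f : ℝ → ℝ × ℝ := fun t => (u t, v t)
  set g : ℝ → ℝ × ℝ := fun t => (u' t, v' t)
  have hf : Continuous f := h.differentiable_fst.continuous.prodMk h.differentiable_snd.continuous
  have hg : Continuous g :=
    h'.differentiable_fst.continuous.prodMk h'.differentiable_snd.continuous
  have hclopen : IsClopen {t | f t = g t} := by
    refine ⟨isClosed_eq hf hg, isOpen_iff_mem_nhds.2 fun t₀ ht₀ => ?_⟩
    obtain ⟨K, s, hs, hlip⟩ := exists_lipschitzOnWith_field m t₀ (x₀ := f t₀)
      (h.radius_pos hm hμ t₀)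
    have hs' : s ∈ 𝓝 (g t₀) := by
      rw [← show f t₀ = g t₀ from ht₀]
      exact hs
    refine ODE_solution_unique_of_eventually (v := field m) (s := fun _ => s) hlip ?_ ?_ ht₀
    · filter_upwards [hf.continuousAt.eventually_mem hs] with t ht
      exact ⟨h.hasDerivAt_field t, ht⟩
    · filter_upwards [hg.continuousAt.eventually_mem hs'] with t ht
      exact ⟨h'.hasDerivAt_field t, ht⟩
  have huniv := hclopen.eq_univ ⟨0, by
    simp [f, g, h.init_fst, h.init_snd, h'.init_fst, h'.init_snd]⟩
  have heq : ∀ t, f t = g t := fun t => by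
    have : t ∈ {t | f t = g t} := huniv ▸ mem_univ t
    exact this
  exact ⟨funext fun t => (congrArg Prod.fst (heq t)).symm,
    funext fun t => (congrArg Prod.snd (heq t)).symm⟩

/-- The time reversal `(u, v) ↦ (v(-t), u(-t))` maps solutions to solutions. -/
lemma timeReversal (h : IsDissipativeSolution m μ u v) :
    IsDissipativeSolution m μ (fun t => v (-t)) (fun t => u (-t)) where
  differentiable_fst := h.differentiable_snd.comp differentiable_neg
  differentiable_snd := h.differentiable_fst.comp differentiable_neg
  eq_fst t := by
    have := h.eq_snd (-t)
    rw [Real.cosh_neg] at this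
    rw [deriv_comp_neg, add_comm (v (-t) ^ 2)]
    exact this
  eq_snd t := by
    have := h.eq_fst (-t)
    rw [Real.cosh_neg] at this
    rw [deriv_comp_neg, neg_neg, add_comm (v (-t) ^ 2)]
    exact this
  init_fst := by simpa using h.init_snd
  init_snd := by simpa using h.init_fst

lemma apply_neg (hm : 3 ≤ m) (hμ : 0 < μ) (h : IsDissipativeSolution m μ u v) (t : ℝ) :
    u (-t) = v t ∧ v (-t) = u t := by
  obtain ⟨h1, h2⟩ := h.unique hm hμ h.timeReversal
  exact ⟨congrFun h2 t, congrFun h1 t⟩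

lemma hamiltonianEnergy_neg (hm : 3 ≤ m) (hμ : 0 < μ) (h : IsDissipativeSolution m μ u v)
    (t : ℝ) : hamiltonianEnergy m u v (-t) = hamiltonianEnergy m u v t := by
  obtain ⟨h1, h2⟩ := h.apply_neg hm hμ t
  unfold hamiltonianEnergy
  rw [h1, h2, Real.cosh_neg, add_comm (v t ^ 2)]
  ring

end IsDissipativeSolution

lemma tendsto_cocompact_of_even {β : Type*} {f : ℝ → β} {l : Filter β}
    (heven : ∀ t, f (-t) = f t) (hf : Tendsto f atTop l) : Tendsto f (cocompact ℝ) l := by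
  have h := hf.comp (tendsto_norm_cocompact_atTop (E := ℝ))
  refine h.congr fun t => ?_
  rcases abs_choice t with ht | ht <;> simp [ht, heven]

lemma isBigO_cocompact_of_even {f g : ℝ → ℝ} (hf : ∀ t, f (-t) = f t) (hg : ∀ t, g (-t) = g t)
    (h : f =O[atTop] g) : f =O[cocompact ℝ] g := by
  have h' := h.comp_tendsto (tendsto_norm_cocompact_atTop (E := ℝ))
  refine h'.congr (fun t => ?_) fun t => ?_ <;>
  rcases abs_choice t with ht | ht <;> simp [ht, hf, hg]

/-! ### From polar to Cartesian coordinates -/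

/-- The first Cartesian coordinate of a trajectory with angle `φ/2` and squared radius `e^z`. -/
noncomputable def polarFst (φ z : ℝ → ℝ) (t : ℝ) : ℝ := Real.exp (z t / 2) * Real.cos (φ t / 2)

/-- The second Cartesian coordinate of a trajectory with angle `φ/2` and squared radius `e^z`. -/
noncomputable def polarSnd (φ z : ℝ → ℝ) (t : ℝ) : ℝ := Real.exp (z t / 2) * Real.sin (φ t / 2)

lemma polarFst_sq_add_polarSnd_sq (φ z : ℝ → ℝ) (t : ℝ) :
    polarFst φ z t ^ 2 + polarSnd φ z t ^ 2 = Real.exp (z t) := by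
  have h1 : Real.exp (z t / 2) * Real.exp (z t / 2) = Real.exp (z t) := by
    rw [← Real.exp_add]
    ring_nf
  have h2 := Real.sin_sq_add_cos_sq (φ t / 2)
  unfold polarFst polarSnd
  linear_combination h1 + Real.exp (z t / 2) ^ 2 * h2

lemma hamiltonianEnergy_polar {m : ℕ} (hm : 3 ≤ m) (φ z : ℝ → ℝ) (t : ℝ) :
    hamiltonianEnergy m (polarFst φ z) (polarSnd φ z) t =
      ((m : ℝ) - 1) / (4 * m) * polarEnergy m φ z t := by
  have hm' : (3 : ℝ) ≤ m := by exact_mod_cast hm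
  have hne : (m : ℝ) - 1 ≠ 0 := by linarith
  have hm0 : (m : ℝ) ≠ 0 := by linarith
  unfold hamiltonianEnergy
  rw [polarFst_sq_add_polarSnd_sq, ← Real.exp_mul,
    show z t * ((m : ℝ) / ((m : ℝ) - 1)) = z t + z t / ((m : ℝ) - 1) by field_simp; ring,
    Real.exp_add]
  have h1 : Real.exp (z t / 2) * Real.exp (z t / 2) = Real.exp (z t) := by
    rw [← Real.exp_add]
    ring_nf
  have h2 : Real.sin (φ t) = 2 * Real.sin (φ t / 2) * Real.cos (φ t / 2) := by
    rw [← Real.sin_two_mul]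
    ring_nf
  unfold polarFst polarSnd polarEnergy polarForcing
  rw [h2, ← h1]
  field_simp
  ring

namespace IsPolarSolution

variable {m : ℕ} {ζ μ : ℝ} {φ z : ℝ → ℝ}

theorem isDissipativeSolution (hμ : 0 < μ)
    (h : IsPolarSolution m (Real.log (2 * μ ^ 2)) φ z) :
    IsDissipativeSolution m μ (polarFst φ z) (polarSnd φ z) := by
  have hpow : ∀ t, Real.cosh t ^ (-(1 / ((m : ℝ) - 1))) *
      (polarFst φ z t ^ 2 + polarSnd φ z t ^ 2) ^ (1 / ((m : ℝ) - 1)) =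
      polarForcing m t (z t) / 2 := fun t => by
    rw [polarFst_sq_add_polarSnd_sq, ← Real.exp_mul, polarForcing, mul_one_div]
    ring
  have hexp : Real.exp (Real.log (2 * μ ^ 2) / 2) = Real.sqrt 2 * μ := by
    rw [Real.exp_half, Real.exp_log (by positivity), Real.sqrt_mul (by norm_num),
      Real.sqrt_sq hμ.le]
  have hd1 : ∀ t, HasDerivAt (polarFst φ z) (polarForcing m t (z t) / 2 * polarSnd φ z t -
      ((m : ℝ) - 2) / 2 * polarFst φ z t) t := fun t => by
    refine (((h.logRadius t).div_const 2).exp.mul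
      ((h.angle t).div_const 2).cos).congr_deriv ?_
    have h1 := Real.cos_sub (φ t) (φ t / 2)
    rw [show φ t - φ t / 2 = φ t / 2 by ring] at h1
    unfold polarFst polarSnd
    linear_combination ((m : ℝ) - 2) / 2 * Real.exp (z t / 2) * h1
  have hd2 : ∀ t, HasDerivAt (polarSnd φ z) (((m : ℝ) - 2) / 2 * polarSnd φ z t -
      polarForcing m t (z t) / 2 * polarFst φ z t) t := fun t => by
    refine (((h.logRadius t).div_const 2).exp.mul
      ((h.angle t).div_const 2).sin).congr_deriv ?_
    have h1 := Real.sin_sub (φ t) (φ t / 2)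
    rw [show φ t - φ t / 2 = φ t / 2 by ring] at h1
    unfold polarFst polarSnd
    linear_combination -(((m : ℝ) - 2) / 2 * Real.exp (z t / 2)) * h1
  have hangle : φ 0 / 2 = Real.pi / 4 := by
    rw [h.angle_zero]
    ring
  have hsqrt := Real.mul_self_sqrt (show (0 : ℝ) ≤ 2 by norm_num)
  refine ⟨fun t => (hd1 t).differentiableAt, fun t => (hd2 t).differentiableAt, fun t => ?_,
    fun t => ?_, ?_, ?_⟩
  · rw [(hd1 t).deriv, hpow]
    ring
  · rw [(hd2 t).deriv, hpow]
    ring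
  · rw [polarFst, h.logRadius_zero, hexp, hangle, Real.cos_pi_div_four]
    linear_combination μ / 2 * hsqrt
  · rw [polarSnd, h.logRadius_zero, hexp, hangle, Real.sin_pi_div_four]
    linear_combination μ / 2 * hsqrt

lemma IsTrapped.changesSignExactly (hm : 3 ≤ m) (h : IsPolarSolution m ζ φ z) {k : ℕ}
    (hk : IsTrapped m φ z k) : ChangesSignExactly (polarSnd φ z) (Ioi 0) k := by
  obtain ⟨s, hs, hE, h1, h2⟩ := id hk
  have h3 := (h.mem_sector_of_energy_nonpos hm hs hE h1 h2 (by linarith : s ≤ s + 1)).2.2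
  exact changesSignExactly_of_angle (ρ := fun t => Real.exp (z t / 2)) h.continuous_angle
    (fun t => Real.exp_pos _) h.angle_zero h.angle_lt_of_le
    (fun t _ => IsTrapped.angle_gt hm h hk t) (by linarith : 0 < s + 1)
    (by linarith [Real.pi_pos])

lemma IsDecaying.changesSignExactly (hm : 3 ≤ m) (h : IsPolarSolution m ζ φ z) {k : ℕ}
    (hk : IsDecaying m φ z k) : ChangesSignExactly (polarSnd φ z) (Ioi 0) k := by
  obtain ⟨T, hT, hT0⟩ := ((hk.2.eventually_lt_const
    (show -(2 * Real.pi * k) < -(2 * Real.pi * k) + 2 * Real.pi by linarith [Real.pi_pos])).and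
    (eventually_gt_atTop 0)).exists
  exact changesSignExactly_of_angle (ρ := fun t => Real.exp (z t / 2)) h.continuous_angle
    (fun t => Real.exp_pos _) h.angle_zero h.angle_lt_of_le
    (fun t ht => IsDecaying.angle_gt hm h hk ht.le) hT0 hT

lemma IsTrapped.not_energy_pos {k : ℕ} (hk : IsTrapped m φ z k) :
    ¬ ∀ t, 0 ≤ t → 0 < polarEnergy m φ z t := fun hE => by
  obtain ⟨s, hs, hEs, -, -⟩ := hk
  exact absurd (hE s hs) (not_lt.2 hEs)

end IsPolarSolution

/-! ### The classes of initial data -/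

section Classes

open IsPolarSolution

variable {m : ℕ} {φ z : ℝ → ℝ → ℝ}

/-- The energy is even in time and strictly decreasing for positive times, so it has a limit in the
extended reals, which is negative once the energy is nonpositive somewhere. -/
lemma exists_energy_limit {μ : ℝ} {φ z : ℝ → ℝ} (hm : 3 ≤ m) (hμ : 0 < μ)
    (h : IsPolarSolution m (Real.log (2 * μ ^ 2)) φ z) {s : ℝ} (hs : 0 ≤ s)
    (hE : polarEnergy m φ z s ≤ 0) :
    ∃ L : EReal, L < 0 ∧ Tendsto (fun t : ℝ =>
      (hamiltonianEnergy m (polarFst φ z) (polarSnd φ z) t : EReal)) (cocompact ℝ) (𝓝 L) := by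
  have hm' : (3 : ℝ) ≤ m := by exact_mod_cast hm
  have hc : 0 < ((m : ℝ) - 1) / (4 * m) := by
    apply div_pos <;> linarith
  have hstrict := h.strictAntiOn_energy hm
  set H := hamiltonianEnergy m (polarFst φ z) (polarSnd φ z) with hH
  have hHE : ∀ t, H t = ((m : ℝ) - 1) / (4 * m) * polarEnergy m φ z t :=
    hamiltonianEnergy_polar hm φ z
  have hanti : Antitone fun t : ℝ => (H (max t 0) : EReal) := fun a b hab => by
    rw [EReal.coe_le_coe_iff, hHE, hHE]
    apply mul_le_mul_of_nonneg_left _ hc.le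
    exact hstrict.antitoneOn (mem_Ici.2 (le_max_right _ _)) (mem_Ici.2 (le_max_right _ _))
      (max_le_max_right 0 hab)
  refine ⟨⨅ t : ℝ, (H (max t 0) : EReal), ?_, ?_⟩
  · refine lt_of_le_of_lt (iInf_le _ (s + 1)) ?_
    rw [max_eq_left (by linarith), hHE]
    have h1 := hstrict (mem_Ici.2 hs) (mem_Ici.2 (by linarith : 0 ≤ s + 1)) (by linarith)
    exact_mod_cast mul_neg_of_pos_of_neg hc (h1.trans_le hE)
  · apply tendsto_cocompact_of_even
    · intro t
      rw [hH, (h.isDissipativeSolution hμ).hamiltonianEnergy_neg hm hμ]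
    · refine (tendsto_atTop_iInf hanti).congr' ?_
      filter_upwards [eventually_ge_atTop 0] with t ht
      rw [max_eq_left ht]

lemma mem_classA_iff (hm : 3 ≤ m) (h : ∀ ζ, IsPolarSolution m ζ (φ ζ) (z ζ)) {μ : ℝ} {k : ℕ} :
    μ ∈ classA m (fun μ => polarFst (φ (Real.log (2 * μ ^ 2))) (z (Real.log (2 * μ ^ 2))))
      (fun μ => polarSnd (φ (Real.log (2 * μ ^ 2))) (z (Real.log (2 * μ ^ 2)))) k ↔
      0 < μ ∧ IsTrapped m (φ (Real.log (2 * μ ^ 2))) (z (Real.log (2 * μ ^ 2))) k := by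
  have hm' : (3 : ℝ) ≤ m := by exact_mod_cast hm
  have hc : 0 < ((m : ℝ) - 1) / (4 * m) := by
    apply div_pos <;> linarith
  have hp := h (Real.log (2 * μ ^ 2))
  constructor
  · rintro ⟨hμ, hsign, L, hL, hlim⟩
    refine ⟨hμ, ?_⟩
    obtain ⟨j, hj | hj⟩ := hp.exists_isTrapped_or_isDecaying hm
    · rwa [hsign.unique (IsTrapped.changesSignExactly hm hp hj)]
    · exfalso
      have hle : (atTop : Filter ℝ) ≤ cocompact ℝ := atTop_le_cocompact
      obtain ⟨t, ht, ht0⟩ := (((hlim.mono_left hle).eventually_lt_const hL).and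
        (eventually_ge_atTop 0)).exists
      rw [hamiltonianEnergy_polar hm] at ht
      have h1 : ((m : ℝ) - 1) / (4 * m) * polarEnergy m (φ (Real.log (2 * μ ^ 2)))
        (z (Real.log (2 * μ ^ 2))) t < 0 := by exact_mod_cast ht
      exact absurd (mul_pos hc (hj.1 t ht0)) (not_lt.2 h1.le)
  · rintro ⟨hμ, hk⟩
    obtain ⟨s, hs, hE, -, -⟩ := id hk
    exact ⟨hμ, IsTrapped.changesSignExactly hm hp hk, exists_energy_limit hm hμ hp hs hE⟩

lemma mem_classI_iff (hm : 3 ≤ m) (h : ∀ ζ, IsPolarSolution m ζ (φ ζ) (z ζ)) {μ : ℝ} {k : ℕ} :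
    μ ∈ classI m (fun μ => polarFst (φ (Real.log (2 * μ ^ 2))) (z (Real.log (2 * μ ^ 2))))
      (fun μ => polarSnd (φ (Real.log (2 * μ ^ 2))) (z (Real.log (2 * μ ^ 2)))) k ↔
      0 < μ ∧ IsDecaying m (φ (Real.log (2 * μ ^ 2))) (z (Real.log (2 * μ ^ 2))) k := by
  have hm' : (3 : ℝ) ≤ m := by exact_mod_cast hm
  have hc : 0 < ((m : ℝ) - 1) / (4 * m) := by
    apply div_pos <;> linarith
  have hp := h (Real.log (2 * μ ^ 2))
  constructor
  · rintro ⟨hμ, hsign, hH⟩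
    refine ⟨hμ, ?_⟩
    have hE : ∀ t, 0 ≤ t → 0 < polarEnergy m (φ (Real.log (2 * μ ^ 2)))
        (z (Real.log (2 * μ ^ 2))) t := fun t _ => by
      have := hH t
      rw [hamiltonianEnergy_polar hm] at this
      exact pos_of_mul_pos_right this hc.le
    obtain ⟨j, hj⟩ := hp.exists_isDecaying_of_energy_pos hm hE
    rwa [hsign.unique (IsDecaying.changesSignExactly hm hp hj)]
  · rintro ⟨hμ, hk⟩
    refine ⟨hμ, IsDecaying.changesSignExactly hm hp hk, fun t => ?_⟩
    have hpos : ∀ t, 0 ≤ t → 0 < hamiltonianEnergy m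
        (polarFst (φ (Real.log (2 * μ ^ 2))) (z (Real.log (2 * μ ^ 2))))
        (polarSnd (φ (Real.log (2 * μ ^ 2))) (z (Real.log (2 * μ ^ 2)))) t := fun t ht => by
      rw [hamiltonianEnergy_polar hm]
      exact mul_pos hc (hk.1 t ht)
    rcases le_total 0 t with ht | ht
    · exact hpos t ht
    · have := hpos (-t) (by linarith)
      rwa [(hp.isDissipativeSolution hμ).hamiltonianEnergy_neg hm hμ] at this

end Classes

theorem theorem1p3 (m : ℕ) (hm : 3 ≤ m) :
    ∃ u v : ℝ → ℝ → ℝ,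
      -- `(u μ, v μ)` is the global solution with initial datum `u(0) = v(0) = μ > 0`
      (∀ μ : ℝ, 0 < μ → IsDissipativeSolution m μ (u μ) (v μ) ∧
        ∀ u' v' : ℝ → ℝ, IsDissipativeSolution m μ u' v' → u' = u μ ∧ v' = v μ) ∧
      -- there are exactly two types of initial data
      ((⋃ k : ℕ, classA m u v k) ∪ (⋃ k : ℕ, classI m u v k) = Ioi 0 ∧
        Disjoint (⋃ k : ℕ, classA m u v k) (⋃ k : ℕ, classI m u v k)) ∧
      -- (1)
      (∀ k : ℕ, (classA m u v k).Nonempty ∧ IsOpen (classA m u v k) ∧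
        Bornology.IsBounded (classA m u v k)) ∧
      -- (2)
      ((∀ k : ℕ, sSup (classA m u v k) ∈ classI m u v k) ∧
        StrictMono (fun k : ℕ => sSup (classA m u v k)) ∧
        Tendsto (fun k : ℕ => sSup (classA m u v k)) atTop atTop) ∧
      -- (3)
      (∀ k : ℕ, (classI m u v k).Nonempty ∧ BddAbove (classI m u v k) ∧
        ∃ ε : ℝ, 0 < ε ∧
          Ioo (sSup (classI m u v k)) (sSup (classI m u v k) + ε) ⊆ classA m u v (k + 1)) ∧
      -- (4)
      (∀ k : ℕ, ∀ μ ∈ classI m u v k,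
        Tendsto (fun t : ℝ => (u μ t, v μ t)) (cocompact ℝ) (𝓝 (0, 0)) ∧
        (fun t : ℝ => u μ t ^ 2 + v μ t ^ 2) =O[cocompact ℝ]
          (fun t : ℝ => Real.exp (-((m : ℝ) - 2) * |t|))) ∧
      -- (5)
      (∀ k : ℕ, ∀ μ ∈ classA m u v k,
        (∃ c : ℝ, 0 < c ∧ ∀ t : ℝ, c ≤ u μ t ^ 2 + v μ t ^ 2) ∧
        Tendsto (fun t : ℝ => u μ t ^ 2 + v μ t ^ 2) (cocompact ℝ) atTop ∧
        (fun t : ℝ => u μ t ^ 2 + v μ t ^ 2) =O[cocompact ℝ] (fun t : ℝ => Real.cosh t)) := by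
  have hm' : (3 : ℝ) ≤ m := by exact_mod_cast hm
  choose φ z h using fun ζ => exists_isPolarSolution hm ζ
  set u : ℝ → ℝ → ℝ :=
    fun μ => polarFst (φ (Real.log (2 * μ ^ 2))) (z (Real.log (2 * μ ^ 2))) with hu
  set v : ℝ → ℝ → ℝ :=
    fun μ => polarSnd (φ (Real.log (2 * μ ^ 2))) (z (Real.log (2 * μ ^ 2))) with hv
  have hA : ∀ k μ, μ ∈ classA m u v k ↔
      0 < μ ∧ IsPolarSolution.IsTrapped m (φ (Real.log (2 * μ ^ 2)))
        (z (Real.log (2 * μ ^ 2))) k := fun k μ => mem_classA_iff hm h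
  have hI : ∀ k μ, μ ∈ classI m u v k ↔
      0 < μ ∧ IsPolarSolution.IsDecaying m (φ (Real.log (2 * μ ^ 2)))
        (z (Real.log (2 * μ ^ 2))) k := fun k μ => mem_classI_iff hm h
  have hsol : ∀ μ, 0 < μ → IsDissipativeSolution m μ (u μ) (v μ) := fun μ hμ =>
    (h _).isDissipativeSolution hμ
  have hradius : ∀ μ t, u μ t ^ 2 + v μ t ^ 2 = Real.exp (z (Real.log (2 * μ ^ 2)) t) :=
    fun μ t => polarFst_sq_add_polarSnd_sq _ _ t
  have heven : ∀ μ, 0 < μ → ∀ t, u μ (-t) ^ 2 + v μ (-t) ^ 2 = u μ t ^ 2 + v μ t ^ 2 :=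
    fun μ hμ t => by
      obtain ⟨h1, h2⟩ := (hsol μ hμ).apply_neg hm hμ t
      rw [h1, h2, add_comm]
  have hcont : ∀ μ : ℝ, 0 < μ → ContinuousAt (fun μ : ℝ => Real.log (2 * μ ^ 2)) μ := fun μ hμ =>
    ContinuousAt.log (by fun_prop) (by positivity)
  have hcover : ∀ μ, 0 < μ → ∃ k, μ ∈ classA m u v k ∨ μ ∈ classI m u v k := fun μ hμ => by
    obtain ⟨k, hk | hk⟩ := (h (Real.log (2 * μ ^ 2))).exists_isTrapped_or_isDecaying hm
    · exact ⟨k, Or.inl ((hA k μ).2 ⟨hμ, hk⟩)⟩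
    · exact ⟨k, Or.inr ((hI k μ).2 ⟨hμ, hk⟩)⟩
  have hAI : ∀ k l μ, μ ∈ classA m u v k → μ ∉ classI m u v l := fun k l μ hk hl =>
    ((hA k μ).1 hk).2.not_energy_pos ((hI l μ).1 hl).2.1
  have hopen : ∀ k, IsOpen (classA m u v k) := fun k => isOpen_iff_mem_nhds.2 fun μ hμ => by
    obtain ⟨hμ0, hk⟩ := (hA k μ).1 hμ
    filter_upwards [eventually_gt_nhds hμ0, (hcont μ hμ0).eventually (eventually_isTrapped hm h hk)]
      with y hy0 hy
    exact (hA k y).2 ⟨hy0, hy⟩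
  have hbdd : ∀ k, BddAbove (classA m u v k ∪ classI m u v k) := fun k => by
    obtain ⟨C, hC⟩ := exists_forall_le_of_index hm h k
    refine ⟨max 1 (Real.exp C), fun μ hμ => ?_⟩
    have hμ' : 0 < μ ∧ Real.log (2 * μ ^ 2) ≤ C := by
      rcases hμ with hμ | hμ
      · exact ⟨((hA k μ).1 hμ).1, hC _ (Or.inl ((hA k μ).1 hμ).2)⟩
      · exact ⟨((hI k μ).1 hμ).1, hC _ (Or.inr ((hI k μ).1 hμ).2)⟩
    have h1 := (Real.log_le_iff_le_exp (by have := hμ'.1; positivity)).1 hμ'.2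
    by_contra! hlt
    have h2 := (le_max_left _ _).trans_lt hlt
    have h3 := (le_max_right _ _).trans_lt hlt
    nlinarith
  have hA0 : (classA m u v 0).Nonempty := by
    obtain ⟨ζ, hζ⟩ := exists_isTrapped_zero hm h
    have hlog : Real.log (2 * Real.sqrt (Real.exp ζ / 2) ^ 2) = ζ := by
      rw [Real.sq_sqrt (by positivity), mul_div_cancel₀ _ (by norm_num), Real.log_exp]
    refine ⟨Real.sqrt (Real.exp ζ / 2), (hA 0 _).2 ⟨by positivity, ?_⟩⟩
    rwa [hlog]
  have hnear : ∀ k, ∀ μ ∈ classI m u v k, ∀ᶠ y in 𝓝 μ,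
      y ∈ classA m u v k ∨ y ∈ classI m u v k ∨ y ∈ classA m u v (k + 1) := fun k μ hμ => by
    obtain ⟨hμ0, hk⟩ := (hI k μ).1 hμ
    filter_upwards [eventually_gt_nhds hμ0,
      (hcont μ hμ0).eventually (eventually_of_isDecaying hm h hk)] with y hy0 hy
    rw [hA, hI, hA]
    exact hy.imp (⟨hy0, ·⟩) (Or.imp (⟨hy0, ·⟩) (⟨hy0, ·⟩))
  obtain ⟨hmain, hmono, htop⟩ := alternating_families hcover (fun k μ hμ => hμ.1)
    (fun k μ hμ => hμ.1) (fun k l μ hk hl => hk.2.1.unique hl.2.1)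
    (fun k l μ hk hl => hk.2.1.unique hl.2.1) hAI hopen hA0
    (fun k => (hbdd k).mono subset_union_left) (fun k => (hbdd k).mono subset_union_right) hnear
  refine ⟨u, v, fun μ hμ => ⟨hsol μ hμ, fun u' v' h' => (hsol μ hμ).unique hm hμ h'⟩, ⟨?_, ?_⟩,
    fun k => ⟨(hmain k).1, hopen k, ?_⟩, ⟨fun k => (hmain k).2.1, hmono, htop⟩,
    fun k => ⟨⟨_, (hmain k).2.1⟩, (hbdd k).mono subset_union_right, (hmain k).2.2⟩, ?_, ?_⟩
  · ext μ
    simp only [mem_union, mem_iUnion, mem_Ioi]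
    constructor
    · rintro (⟨k, hk⟩ | ⟨k, hk⟩) <;> exact hk.1
    · intro hμ
      obtain ⟨k, hk | hk⟩ := hcover μ hμ
      · exact Or.inl ⟨k, hk⟩
      · exact Or.inr ⟨k, hk⟩
  · rw [disjoint_iUnion_left]
    intro k
    rw [disjoint_iUnion_right]
    exact fun l => disjoint_left.2 (hAI k l)
  · exact isBounded_iff_bddBelow_bddAbove.2
      ⟨⟨0, fun μ hμ => hμ.1.le⟩, (hbdd k).mono subset_union_left⟩
  · intro k μ hμ
    obtain ⟨hμ0, hk⟩ := (hI k μ).1 hμ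
    have hO : (fun t : ℝ => u μ t ^ 2 + v μ t ^ 2) =O[cocompact ℝ]
        (fun t : ℝ => Real.exp (-((m : ℝ) - 2) * |t|)) := by
      refine isBigO_cocompact_of_even (heven μ hμ0) (fun t => by rw [abs_neg]) ?_
      obtain ⟨C, hC⟩ := hk.exists_logRadius_le hm (h _)
      refine IsBigO.of_bound (Real.exp C) ?_
      filter_upwards [hC, eventually_ge_atTop 0] with t ht ht0
      rw [hradius, Real.norm_eq_abs, Real.norm_eq_abs, Real.abs_exp, Real.abs_exp, ← Real.exp_add,
        abs_of_nonneg ht0, Real.exp_le_exp]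
      linarith
    have hzero : Tendsto (fun t : ℝ => u μ t ^ 2 + v μ t ^ 2) (cocompact ℝ) (𝓝 0) := by
      refine hO.trans_tendsto (Real.tendsto_exp_atBot.comp ?_)
      exact (tendsto_norm_cocompact_atTop (E := ℝ)).const_mul_atTop_of_neg (by linarith)
    have hsqrt : Tendsto (fun t : ℝ => Real.sqrt (u μ t ^ 2 + v μ t ^ 2)) (cocompact ℝ) (𝓝 0) := by
      simpa using hzero.sqrt
    refine ⟨Tendsto.prodMk_nhds (squeeze_zero_norm (fun t => ?_) hsqrt)
      (squeeze_zero_norm (fun t => ?_) hsqrt), hO⟩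
    · exact Real.abs_le_sqrt (by linarith [sq_nonneg (v μ t)])
    · exact Real.abs_le_sqrt (by linarith [sq_nonneg (u μ t)])
  · intro k μ hμ
    obtain ⟨hμ0, hk⟩ := (hA k μ).1 hμ
    have hlim : Tendsto (fun t : ℝ => u μ t ^ 2 + v μ t ^ 2) (cocompact ℝ) atTop := by
      refine tendsto_cocompact_of_even (heven μ hμ0) ?_
      simp only [hradius]
      exact hk.tendsto_exp_logRadius hm (h _)
    refine ⟨?_, hlim, ?_⟩
    · have hc : Continuous fun t : ℝ => u μ t ^ 2 + v μ t ^ 2 := by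
        simp only [hradius]
        exact Real.continuous_exp.comp (h _).continuous_logRadius
      obtain ⟨t₀, ht₀⟩ := hc.exists_forall_le hlim
      exact ⟨_, (hsol μ hμ0).radius_pos hm hμ0 t₀, ht₀⟩
    · refine isBigO_cocompact_of_even (heven μ hμ0) Real.cosh_neg ?_
      obtain ⟨C, hC⟩ := hk.exists_exp_logRadius_le hm (h _)
      refine IsBigO.of_bound C ?_
      filter_upwards [hC] with t ht
      rwa [hradius, Real.norm_eq_abs, Real.norm_eq_abs, Real.abs_exp,
        abs_of_pos (Real.cosh_pos t)]
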